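/- Let $N\ge 1$ and let $d_0,\dots,d_N$ be layer widths, $m=d_0$, $n=d_N\ge 1$. For a tuple $\overrightarrow W=(W_1,\dots,W_N)$ with $W_j\in\mathbb R^{d_j\times d_{j-1}}$ write $W=W_N\cdots W_1\in\mathbb R^{n\times m}$ and $\Sigma=WW^\top$. Let $\Sigma_0\in\mathbb R^{n\times n}$ be symmetric positive semidefinite, and consider the Bures-Wasserstein loss $$L(\Sigma)=\operatorname{tr}\Big(\Sigma+\Sigma_0-2\big(\Sigma_0^{1/2}\Sigma\,\Sigma_0^{1/2}\big)^{1/2}\Big),\qquad L^N(\overrightarrow W)=L(WW^\top).$$ Let $c>0$ and let $t\mapsto\overrightarrow W(t)$ be a solution on $[0,T]$ (with $T$ arbitrary; thus solutions on $[0,\infty)$ are covered) of the gradient flow $\dot{\overrightarrow W}(t)=-\nabla L^N(\overrightarrow W(t))$ with respect to the Frobenius inner product. Write $\Sigma(t)=W(t)W(t)^\top$. Assume that the initial weights are balanced, $W_j(0)W_j(0)^\top=W_{j+1}(0)^\top W_{j+1}(0)$ for $1\le j\le N-1$, and that $\Sigma(0)$ has modified deficiency margin $c$ with respect to $\Sigma_0$,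 i.e. $$\min_{U\in\mathcal O(n)}\big\|\Sigma(0)^{1/2}-\Sigma_0^{1/2}U\big\|_F\le\sigma_{\min}(\Sigma_0^{1/2})-c .$$ Let $\Sigma^*$ be a minimizer of $L$ over the symmetric positive definite $n\times n$ matrices, and put $$K=\frac{\sqrt{c^2\lambda_{\min}(\Sigma_0)}}{2C^2},\qquad C=2\big(L(\Sigma(0))+\operatorname{tr}\Sigma_0\big).$$ Then, for every $t\in[0,T]$, the loss $L^N$ is differentiable at $\overrightarrow W(t)$, $\lambda_{\min}(\Sigma(t))\ge c^2$, and $$L(\Sigma(t))-L(\Sigma^*)\le e^{-8N c^{\frac{2(2N-1)}{N}}Kt}\,\Delta_0^*,$$ both with $\Delta_0^*=L(\Sigma(0))-L(\Sigma^*)$ and with $\Delta_0^*=\|\Sigma(0)-\Sigma^*\|_F$. -/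

import Mathlib

open Matrix

noncomputable section

namespace BWFlow

section Matrices

open scoped MatrixOrder

/-- The positive semidefinite square root `A^{1/2}` of a positive semidefinite matrix. -/
def msqrt {n : ℕ} (A : Matrix (Fin n) (Fin n) ℝ) : Matrix (Fin n) (Fin n) ℝ :=
  CFC.sqrt A

end Matrices

/-- The Frobenius norm `‖A‖_F = √⟨A, A⟩`, where `⟨A, B⟩ = tr (Aᵀ B)`. -/
def frobNorm {m n : ℕ} (A : Matrix (Fin m) (Fin n) ℝ) : ℝ :=
  Real.sqrt (Aᵀ * A).trace

/-- The smallest eigenvalue of a symmetric real matrix (of positive size). -/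
def lambdaMin {n : ℕ} (A : Matrix (Fin n) (Fin n) ℝ) : ℝ :=
  sInf (spectrum ℝ A)

/-- The smallest singular value of a square real matrix (of positive size). -/
def sigmaMin {n : ℕ} (A : Matrix (Fin n) (Fin n) ℝ) : ℝ :=
  Real.sqrt (lambdaMin (Aᵀ * A))

/-- The loss in covariance space: the squared Bures-Wasserstein distance of `S` to the target,
`L(Σ) = tr (Σ + Σ₀ - 2 (Σ₀^{1/2} Σ Σ₀^{1/2})^{1/2})`. -/
def bwLoss {n : ℕ} (S₀ S : Matrix (Fin n) (Fin n) ℝ) : ℝ :=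
  (S + S₀ - (2 : ℝ) • msqrt (msqrt S₀ * S * msqrt S₀)).trace

/-- `S` has modified deficiency margin `c` with respect to `S₀`:
`min_{U ∈ O(n)} ‖Σ^{1/2} - Σ₀^{1/2} U‖_F ≤ σ_min (Σ₀^{1/2}) - c`. -/
def HasModifiedDeficiencyMargin {n : ℕ} (S₀ S : Matrix (Fin n) (Fin n) ℝ) (c : ℝ) : Prop :=
  (⨅ U : Matrix.orthogonalGroup (Fin n) ℝ,
    frobNorm (msqrt S - msqrt S₀ * (U : Matrix (Fin n) (Fin n) ℝ))) ≤ sigmaMin (msqrt S₀) - c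

/-- The parameter space of a linear network with `N` layers and widths `d 0, …, d N`
(only these values of `d` matter). The Hilbert space structure is
`⟨V, W⟩ = ∑ j, tr (V_jᵀ W_j)`. -/
abbrev Params (N : ℕ) (d : ℕ → ℕ) : Type :=
  PiLp 2 (fun j : Fin N => EuclideanSpace ℝ (Fin (d (j.1 + 1)) × Fin (d j.1)))

variable {N : ℕ} {d : ℕ → ℕ}

/-- The weight matrix `W_{j+1}`, of size `d (j+1) × d j`, for `j = 0, …, N-1`. -/
def layer (W : Params N d) (j : ℕ) (hj : j < N) : Matrix (Fin (d (j + 1))) (Fin (d j)) ℝ :=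
  Matrix.of fun a b => W ⟨j, hj⟩ (a, b)

/-- The partial product `W_k ⋯ W_1`, for `k ≤ N` (the identity if `k = 0`). -/
def partialProd (W : Params N d) : (k : ℕ) → k ≤ N → Matrix (Fin (d k)) (Fin (d 0)) ℝ
  | 0, _ => 1
  | k + 1, h => layer W k h * partialProd W k (Nat.le_of_succ_le h)

/-- The end-to-end matrix `W = W_N ⋯ W_1`. -/
def endToEnd (W : Params N d) : Matrix (Fin (d N)) (Fin (d 0)) ℝ :=
  partialProd W N le_rfl

/-- The covariance matrix `Σ = W Wᵀ` of the end-to-end matrix `W`. -/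
def covariance (W : Params N d) : Matrix (Fin (d N)) (Fin (d N)) ℝ :=
  endToEnd W * (endToEnd W)ᵀ

/-- The loss `L^N` in parameter space. -/
def paramLoss (S₀ : Matrix (Fin (d N)) (Fin (d N)) ℝ) (W : Params N d) : ℝ :=
  bwLoss S₀ (covariance W)

/-- Balanced weights: `W_j W_jᵀ = W_{j+1}ᵀ W_{j+1}` for all `1 ≤ j ≤ N - 1`. -/
def Balanced (W : Params N d) : Prop :=
  ∀ (j : ℕ) (h : j + 1 < N),
    layer W j (Nat.lt_of_succ_lt h) * (layer W j (Nat.lt_of_succ_lt h))ᵀ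
      = (layer W (j + 1) h)ᵀ * layer W (j + 1) h

/-- `W` solves the gradient flow equation `W'(t) = -∇ L^N (W(t))` on `[0, T]`
(with one-sided derivatives at the end points). -/
def IsGradientFlow (S₀ : Matrix (Fin (d N)) (Fin (d N)) ℝ) (T : ℝ) (W : ℝ → Params N d) : Prop :=
  ∀ t ∈ Set.Icc (0 : ℝ) T,
    HasDerivWithinAt W (-(gradient (paramLoss S₀) (W t))) (Set.Icc 0 T) t

/-- The constant `C = 2 (L(Σ(0)) + tr Σ₀)`, where `S` stands for `Σ(0)`. -/
def constC {n : ℕ} (S₀ S : Matrix (Fin n) (Fin n) ℝ) : ℝ :=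
  2 * (bwLoss S₀ S + S₀.trace)

/-- The constant `K = √(c² λ_min(Σ₀)) / (2 C²)`, where `S` stands for `Σ(0)`. -/
def constK {n : ℕ} (S₀ S : Matrix (Fin n) (Fin n) ℝ) (c : ℝ) : ℝ :=
  Real.sqrt (c ^ 2 * lambdaMin S₀) / (2 * constC S₀ S ^ 2)

end BWFlow

end

/-!
The loss is the squared Procrustes residual `min_U ‖Σ^{1/2} - Σ₀^{1/2} U‖²`, attained at the polar
factor of `Σ₀^{1/2} Σ^{1/2}`. The margin condition is therefore an upper bound on the loss, so it
persists as long as the loss decreases, and Weyl's inequality for singular values turns it into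
`σ_min (Σ^{1/2}) ≥ c`; this bound in turn keeps the loss differentiable along the flow.

With the transport map `Γ = Σ₀^{1/2} (Σ₀^{1/2} Σ Σ₀^{1/2})^{-1/2} Σ₀^{1/2}` one has
`∇L(Σ) = 1 - Γ` and `L(Σ) = tr ((1 - Γ) Σ (1 - Γ))`. The flow preserves balancedness, which makes
`Σ` the `N`-th power of `P = W_N W_Nᵀ`; each layer then contributes at least
`4 λ_min(P)^(N-1) L(Σ)` to the squared gradient, and `λ_min(P) ≥ c^(2/N)`. Summing over the layers
gives the Polyak-Łojasiewicz inequality `‖∇L^N‖² ≥ 4 N c^(2(N-1)/N) L^N`, and Grönwall's inequality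
yields exponential decay at this rate, which is at least the asserted one because
`2 c² K ≤ 1`. Finally `Σ₀` is the only minimizer, and the margin bounds `L(Σ(0))` by
`‖Σ(0) - Σ₀‖_F`.
-/

noncomputable section

namespace BWFlow

section LoewnerOrder

open scoped MatrixOrder

variable {ι κ : Type*}

theorem isSymm_of_posSemidef {A : Matrix ι ι ℝ} (hA : A.PosSemidef) : A.IsSymm :=
  isHermitian_iff_isSymm.1 hA.isHermitian

theorem posSemidef_of_smul_one_le [Finite ι] [DecidableEq ι] {A : Matrix ι ι ℝ} {a : ℝ}
    (ha : 0 ≤ a) (h : a • 1 ≤ A) : A.PosSemidef :=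
  ((PosSemidef.one.smul ha).nonneg.trans h).posSemidef

theorem posDef_of_smul_one_le [Finite ι] [DecidableEq ι] {A : Matrix ι ι ℝ} {a : ℝ}
    (ha : 0 < a) (h : a • 1 ≤ A) : A.PosDef := by
  simpa only [add_sub_cancel] using (PosDef.one.smul ha).add_posSemidef (le_iff.1 h)

variable [Fintype ι]

theorem posSemidef_transpose_mul_mul [Finite κ] {A : Matrix ι ι ℝ} (hA : A.PosSemidef)
    (B : Matrix ι κ ℝ) : (Bᵀ * A * B).PosSemidef := by
  simpa only [conjTranspose_eq_transpose_of_trivial] using hA.conjTranspose_mul_mul_same B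

theorem posSemidef_mul_transpose_self [Finite κ] (B : Matrix κ ι ℝ) : (B * Bᵀ).PosSemidef := by
  simpa only [conjTranspose_eq_transpose_of_trivial] using posSemidef_self_mul_conjTranspose B

theorem posSemidef_transpose_mul_self [Finite κ] (B : Matrix ι κ ℝ) : (Bᵀ * B).PosSemidef := by
  simpa only [conjTranspose_eq_transpose_of_trivial] using posSemidef_conjTranspose_mul_self B

theorem posSemidef_mul_mul_of_isSymm {A B : Matrix ι ι ℝ} (hA : A.PosSemidef) (hB : B.IsSymm) :
    (B * A * B).PosSemidef := by
  simpa only [hB.eq] using posSemidef_transpose_mul_mul hA B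

theorem trace_mul_nonneg {A B : Matrix ι ι ℝ} (hA : A.PosSemidef) (hB : B.PosSemidef) :
    0 ≤ (A * B).trace := by
  classical
  have hR : (CFC.sqrt B).IsSymm := isSymm_of_posSemidef (CFC.sqrt_nonneg B).posSemidef
  calc 0 ≤ (CFC.sqrt B * A * CFC.sqrt B).trace :=
        (posSemidef_mul_mul_of_isSymm hA hR).trace_nonneg
    _ = (A * (CFC.sqrt B * CFC.sqrt B)).trace := by
        rw [Matrix.mul_assoc, trace_mul_comm, Matrix.mul_assoc]
    _ = (A * B).trace := by rw [CFC.sqrt_mul_sqrt_self B hB.nonneg]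

theorem trace_mul_le_trace_mul_right {A B C : Matrix ι ι ℝ} (h : A ≤ B) (hC : C.PosSemidef) :
    (A * C).trace ≤ (B * C).trace := by
  simpa only [Matrix.sub_mul, trace_sub, sub_nonneg] using trace_mul_nonneg (le_iff.1 h) hC

variable [DecidableEq ι]

theorem mul_trace_le_trace_mul {A C : Matrix ι ι ℝ} {a : ℝ} (h : a • 1 ≤ A) (hC : C.PosSemidef) :
    a * C.trace ≤ (A * C).trace := by
  simpa only [Matrix.smul_mul, Matrix.one_mul, trace_smul, smul_eq_mul]
    using trace_mul_le_trace_mul_right h hC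

theorem trace_orthogonal_mul_le {O P : Matrix ι ι ℝ} (hO : O * Oᵀ = 1) (hP : P.PosSemidef) :
    (O * P).trace ≤ P.trace := by
  have h := (posSemidef_transpose_mul_mul hP (1 - O)ᵀ).trace_nonneg
  have hOP : (P * Oᵀ).trace = (O * P).trace := by
    rw [← trace_transpose, transpose_mul, transpose_transpose, (isSymm_of_posSemidef hP).eq]
  have hOPO : (O * P * Oᵀ).trace = P.trace := by
    rw [trace_mul_comm, ← Matrix.mul_assoc, mul_eq_one_comm.1 hO, Matrix.one_mul]
  simp only [transpose_transpose, transpose_sub, transpose_one, Matrix.sub_mul, Matrix.mul_sub,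
    Matrix.one_mul, Matrix.mul_one, trace_sub, hOP, hOPO] at h
  linarith

theorem smul_one_le_iff_forall_spectrum {A : Matrix ι ι ℝ} (hA : A.IsHermitian) {a : ℝ} :
    a • 1 ≤ A ↔ ∀ x ∈ spectrum ℝ A, a ≤ x := by
  rw [← Algebra.algebraMap_eq_smul_one, algebraMap_le_iff_le_spectrum (ha := hA)]

theorem smul_one_le_iff_forall_dotProduct {A : Matrix ι ι ℝ} (hA : A.IsHermitian) {a : ℝ} :
    a • 1 ≤ A ↔ ∀ x : ι → ℝ, a * (x ⬝ᵥ x) ≤ x ⬝ᵥ A *ᵥ x := by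
  have hsub : (A - a • (1 : Matrix ι ι ℝ)).IsHermitian := hA.sub (isHermitian_one.smul rfl)
  simp only [le_iff, posSemidef_iff_dotProduct_mulVec, hsub, true_and, star_trivial, sub_mulVec,
    smul_mulVec, one_mulVec, dotProduct_sub, dotProduct_smul, smul_eq_mul, sub_nonneg]

theorem spectrum_pow_of_isHermitian {A : Matrix ι ι ℝ} (hA : A.IsHermitian) (k : ℕ) :
    spectrum ℝ (A ^ k) = (· ^ k) '' spectrum ℝ A := by
  rw [← cfc_pow_id (R := ℝ) A k (ha := hA), cfc_map_spectrum (R := ℝ) (· ^ k) A (ha := hA)]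

theorem smul_one_le_pow {A : Matrix ι ι ℝ} {a : ℝ} (ha : 0 ≤ a) (h : a • 1 ≤ A) (k : ℕ) :
    a ^ k • 1 ≤ A ^ k := by
  have hA := (posSemidef_of_smul_one_le ha h).isHermitian
  rw [smul_one_le_iff_forall_spectrum hA] at h
  rw [smul_one_le_iff_forall_spectrum (hA.pow k), spectrum_pow_of_isHermitian hA]
  rintro _ ⟨x, hx, rfl⟩
  exact pow_le_pow_left₀ ha (h x hx) k

theorem smul_one_le_of_pow {A : Matrix ι ι ℝ} (hA : A.PosSemidef) {a : ℝ} {k : ℕ} (hk : k ≠ 0)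
    (h : a ^ k • 1 ≤ A ^ k) : a • 1 ≤ A := by
  rw [smul_one_le_iff_forall_spectrum (hA.isHermitian.pow k),
    spectrum_pow_of_isHermitian hA.isHermitian, Set.forall_mem_image] at h
  rw [smul_one_le_iff_forall_spectrum hA.isHermitian]
  intro x hx
  have hx0 : 0 ≤ x := (posSemidef_iff_isHermitian_and_spectrum_nonneg.1 hA).2 hx
  exact le_of_pow_le_pow_left₀ hk hx0 (h hx)

theorem smul_pow_le_pow_add {P : Matrix ι ι ℝ} {p : ℝ} (hp : 0 ≤ p) (h : p • 1 ≤ P) (m k : ℕ) :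
    p ^ k • P ^ m ≤ P ^ (m + k) := by
  have hP := posSemidef_of_smul_one_le hp h
  have hcomm : Commute (P ^ m) (P ^ k - p ^ k • 1) :=
    (Commute.pow_pow_self P m k).sub_right ((Commute.one_right _).smul_right _)
  have hprod := hcomm.mul_nonneg (hP.pow m).nonneg
    (sub_nonneg.2 (smul_one_le_pow hp h k))
  rwa [Matrix.mul_sub, ← pow_add, Matrix.mul_smul, Matrix.mul_one, sub_nonneg] at hprod

theorem pow_mul_trace_conj_pow_le {P G : Matrix ι ι ℝ} (hG : G.IsSymm) {p : ℝ} (hp : 0 ≤ p)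
    (h : p • 1 ≤ P) (a m k : ℕ) :
    p ^ (a + k) * (G * P ^ m * G).trace ≤ (G * P ^ a * G * P ^ (m + k)).trace := by
  have hP := posSemidef_of_smul_one_le hp h
  have hconj (b : ℕ) : (G * P ^ b * G).PosSemidef := posSemidef_mul_mul_of_isSymm (hP.pow b) hG
  calc p ^ (a + k) * (G * P ^ m * G).trace
      = p ^ k * (p ^ a * (G * P ^ m * G).trace) := by ring
    _ ≤ p ^ k * (P ^ a * (G * P ^ m * G)).trace := by
        gcongr
        exact mul_trace_le_trace_mul (smul_one_le_pow hp h a) (hconj m)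
    _ = ((p ^ k • P ^ m) * (G * P ^ a * G)).trace := by
        rw [Matrix.smul_mul, trace_smul, smul_eq_mul, ← Matrix.mul_assoc, trace_mul_comm,
          ← Matrix.mul_assoc, ← Matrix.mul_assoc, ← Matrix.mul_assoc, trace_mul_comm]
        simp only [Matrix.mul_assoc]
    _ ≤ (P ^ (m + k) * (G * P ^ a * G)).trace :=
        trace_mul_le_trace_mul_right (smul_pow_le_pow_add hp h m k) (hconj a)
    _ = (G * P ^ a * G * P ^ (m + k)).trace := trace_mul_comm _ _

end LoewnerOrder

section FrobeniusNorm

open scoped MatrixOrder Matrix.Norms.Frobenius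

variable {ι κ : Type*} [Fintype ι] [Fintype κ]

theorem trace_transpose_mul_eq_sum (A B : Matrix ι κ ℝ) :
    (Aᵀ * B).trace = ∑ i, ∑ j, A i j * B i j := by
  rw [Finset.sum_comm]
  simp only [Matrix.trace, diag_apply, mul_apply, transpose_apply]

theorem norm_sq_eq_sum (A : Matrix ι κ ℝ) : ‖A‖ ^ 2 = ∑ i, ∑ j, A i j ^ 2 := by
  rw [frobenius_norm_def, ← Real.sqrt_eq_rpow, Real.sq_sqrt (by positivity)]
  simp only [Real.rpow_two, Real.norm_eq_abs, sq_abs]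

theorem norm_sq_eq_trace (A : Matrix ι κ ℝ) : ‖A‖ ^ 2 = (Aᵀ * A).trace := by
  rw [norm_sq_eq_sum, trace_transpose_mul_eq_sum]
  simp only [sq]

theorem norm_sq_eq_trace_mul_transpose (A : Matrix ι κ ℝ) : ‖A‖ ^ 2 = (A * Aᵀ).trace := by
  rw [norm_sq_eq_trace, trace_mul_comm]

theorem trace_transpose_mul_le_norm_mul_norm (A B : Matrix ι κ ℝ) :
    (Aᵀ * B).trace ≤ ‖A‖ * ‖B‖ := by
  have h := Real.sum_mul_le_sqrt_mul_sqrt (Finset.univ : Finset (ι × κ))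
    (fun p => A p.1 p.2) (fun p => B p.1 p.2)
  simpa only [Fintype.sum_prod_type, ← trace_transpose_mul_eq_sum, ← norm_sq_eq_sum,
    Real.sqrt_sq (norm_nonneg _)] using h

theorem norm_replicateCol_sq (v : ι → ℝ) : ‖replicateCol Unit v‖ ^ 2 = v ⬝ᵥ v := by
  rw [norm_sq_eq_trace_mul_transpose, transpose_replicateCol, trace_replicateCol_mul_replicateRow]

theorem frobNorm_eq_norm {m n : ℕ} (A : Matrix (Fin m) (Fin n) ℝ) : frobNorm A = ‖A‖ := by
  rw [frobNorm, ← norm_sq_eq_trace, Real.sqrt_sq (norm_nonneg A)]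

/-- With `D = X - Y` one has `X² - Y² = X D + D Y`, and `⟨D, X D⟩ ≥ s ‖D‖²`, `⟨D, D Y⟩ ≥ 0`. -/
theorem mul_norm_sub_le_norm_mul_self_sub [DecidableEq ι] {X Y : Matrix ι ι ℝ} {s : ℝ}
    (hs : 0 ≤ s) (hX : s • 1 ≤ X) (hY : Y.PosSemidef) :
    s * ‖X - Y‖ ≤ ‖X * X - Y * Y‖ := by
  have hsymm : (X - Y).IsSymm :=
    (isSymm_of_posSemidef (posSemidef_of_smul_one_le hs hX)).sub (isSymm_of_posSemidef hY)
  set D := X - Y with hD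
  have hDX : s * (D * D).trace ≤ (D * (X * D)).trace := by
    have hDD : (D * D).PosSemidef := by simpa only [hsymm.eq] using posSemidef_mul_transpose_self D
    simpa only [trace_mul_comm D, Matrix.mul_assoc] using mul_trace_le_trace_mul hX hDD
  have hDY : 0 ≤ (D * (D * Y)).trace := by
    simpa only [trace_mul_comm D] using (posSemidef_mul_mul_of_isSymm hY hsymm).trace_nonneg
  have hinner : ‖D‖ * (s * ‖D‖) ≤ ‖D‖ * ‖X * X - Y * Y‖ :=
    calc ‖D‖ * (s * ‖D‖) = s * (D * D).trace := by
          rw [← congrArg (· * D) hsymm.eq, ← norm_sq_eq_trace]; ring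
      _ ≤ (D * (X * D)).trace + (D * (D * Y)).trace := by linarith
      _ = (Dᵀ * (X * X - Y * Y)).trace := by
          rw [hsymm.eq, ← trace_add, ← Matrix.mul_add, hD]; congr 2; noncomm_ring
      _ ≤ ‖D‖ * ‖X * X - Y * Y‖ := trace_transpose_mul_le_norm_mul_norm _ _
  rcases (norm_nonneg D).eq_or_lt with hzero | hpos
  · rw [← hzero, mul_zero]; exact norm_nonneg _
  · exact le_of_mul_le_mul_left hinner hpos

end FrobeniusNorm

section SquareRoot

open scoped MatrixOrder

variable {n : ℕ} {A : Matrix (Fin n) (Fin n) ℝ}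

theorem posSemidef_msqrt (A : Matrix (Fin n) (Fin n) ℝ) : (msqrt A).PosSemidef :=
  (CFC.sqrt_nonneg A).posSemidef

theorem isSymm_msqrt (A : Matrix (Fin n) (Fin n) ℝ) : (msqrt A).IsSymm :=
  isSymm_of_posSemidef (posSemidef_msqrt A)

theorem msqrt_mul_msqrt (hA : A.PosSemidef) : msqrt A * msqrt A = A :=
  CFC.sqrt_mul_sqrt_self A hA.nonneg

theorem msqrt_mul_self (hA : A.PosSemidef) : msqrt (A * A) = A :=
  CFC.sqrt_mul_self A hA.nonneg

theorem posDef_msqrt (hA : A.PosDef) : (msqrt A).PosDef :=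
  isStrictlyPositive_iff_posDef.1 (isStrictlyPositive_iff_posDef.2 hA).sqrt

end SquareRoot

section Extremal

open scoped MatrixOrder Matrix.Norms.Frobenius

variable {n : ℕ} {A : Matrix (Fin n) (Fin n) ℝ}

theorem sigmaMin_mul_orthogonal (A : Matrix (Fin n) (Fin n) ℝ) (U : orthogonalGroup (Fin n) ℝ) :
    sigmaMin (A * (U : Matrix (Fin n) (Fin n) ℝ)) = sigmaMin A := by
  have h := Unitary.spectrum_star_left_conjugate (R := ℝ) (a := Aᵀ * A) (U := U)
  rw [sigmaMin, sigmaMin, lambdaMin, lambdaMin, transpose_mul, ← h, Matrix.mul_assoc,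
    ← Matrix.mul_assoc Aᵀ, ← Matrix.mul_assoc, star_eq_conjTranspose,
    conjTranspose_eq_transpose_of_trivial]

variable [NeZero n]

theorem le_lambdaMin_iff (hA : A.IsHermitian) {a : ℝ} : a ≤ lambdaMin A ↔ a • 1 ≤ A := by
  have hs := hA.spectrum_real_eq_range_eigenvalues
  have hne : (spectrum ℝ A).Nonempty := hs ▸ Set.range_nonempty _
  have hfin : (spectrum ℝ A).Finite := hs ▸ Set.finite_range _
  rw [smul_one_le_iff_forall_spectrum hA, lambdaMin, le_csInf_iff hfin.bddBelow hne]

theorem lambdaMin_smul_one_le (hA : A.IsHermitian) : lambdaMin A • 1 ≤ A :=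
  (le_lambdaMin_iff hA).1 le_rfl

theorem lambdaMin_nonneg (hA : A.PosSemidef) : 0 ≤ lambdaMin A :=
  (le_lambdaMin_iff hA.isHermitian).2 (by simpa only [zero_smul] using hA.nonneg)

theorem lambdaMin_pos (hA : A.PosDef) : 0 < lambdaMin A := by
  obtain ⟨i, hi⟩ : lambdaMin A ∈ Set.range hA.isHermitian.eigenvalues := by
    rw [← hA.isHermitian.spectrum_real_eq_range_eigenvalues, lambdaMin]
    have hs := hA.isHermitian.spectrum_real_eq_range_eigenvalues
    exact Set.Nonempty.csInf_mem (hs ▸ Set.range_nonempty _) (hs ▸ Set.finite_range _)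
  exact hi ▸ hA.eigenvalues_pos i

theorem lambdaMin_le_trace (hA : A.PosSemidef) : lambdaMin A ≤ A.trace := by
  have h := mul_trace_le_trace_mul (lambdaMin_smul_one_le hA.isHermitian) PosSemidef.one
  rw [Matrix.mul_one, trace_one, Fintype.card_fin] at h
  have hn : (1 : ℝ) ≤ n := mod_cast NeZero.one_le
  nlinarith [lambdaMin_nonneg hA]

theorem sigmaMin_sq (A : Matrix (Fin n) (Fin n) ℝ) : sigmaMin A ^ 2 = lambdaMin (Aᵀ * A) :=
  Real.sq_sqrt (lambdaMin_nonneg (posSemidef_transpose_mul_self A))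

theorem sigmaMin_msqrt_sq (hA : A.PosSemidef) : sigmaMin (msqrt A) ^ 2 = lambdaMin A := by
  rw [sigmaMin_sq, (isSymm_msqrt A).eq, msqrt_mul_msqrt hA]

theorem sigmaMin_mul_norm_le {κ : Type*} [Fintype κ] (A : Matrix (Fin n) (Fin n) ℝ)
    (X : Matrix (Fin n) κ ℝ) : sigmaMin A * ‖X‖ ≤ ‖A * X‖ := by
  refine le_of_sq_le_sq ?_ (norm_nonneg _)
  calc (sigmaMin A * ‖X‖) ^ 2 = lambdaMin (Aᵀ * A) * (X * Xᵀ).trace := by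
        rw [mul_pow, sigmaMin_sq, norm_sq_eq_trace_mul_transpose]
    _ ≤ (Aᵀ * A * (X * Xᵀ)).trace :=
        mul_trace_le_trace_mul (lambdaMin_smul_one_le (posSemidef_transpose_mul_self A).isHermitian)
          (posSemidef_mul_transpose_self X)
    _ = ‖A * X‖ ^ 2 := by
        rw [norm_sq_eq_trace, transpose_mul, ← Matrix.mul_assoc, trace_mul_comm]
        simp only [Matrix.mul_assoc]

theorem le_sigmaMin_of_forall {b : ℝ} (h : ∀ x : Matrix (Fin n) Unit ℝ, b * ‖x‖ ≤ ‖A * x‖) :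
    b ≤ sigmaMin A := by
  rcases lt_or_ge b 0 with hb | hb
  · exact hb.le.trans (Real.sqrt_nonneg _)
  have hH := (posSemidef_transpose_mul_self A).isHermitian
  refine Real.le_sqrt_of_sq_le ((le_lambdaMin_iff hH).2 ?_)
  refine (smul_one_le_iff_forall_dotProduct hH).2 fun x => ?_
  have hx := pow_le_pow_left₀ (by positivity) (h (replicateCol Unit x)) 2
  rwa [mul_pow, ← replicateCol_mulVec, norm_replicateCol_sq, norm_replicateCol_sq,
    dotProduct_mulVec, vecMul_mulVec, ← dotProduct_mulVec] at hx

theorem sigmaMin_sub_norm_le (A B : Matrix (Fin n) (Fin n) ℝ) :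
    sigmaMin B - ‖A - B‖ ≤ sigmaMin A := by
  refine le_sigmaMin_of_forall fun x => ?_
  calc (sigmaMin B - ‖A - B‖) * ‖x‖ = sigmaMin B * ‖x‖ - ‖A - B‖ * ‖x‖ := sub_mul _ _ _
    _ ≤ ‖B * x‖ - ‖(A - B) * x‖ := sub_le_sub (sigmaMin_mul_norm_le B x) (frobenius_norm_mul _ _)
    _ ≤ ‖A * x‖ := by
        rw [sub_le_iff_le_add, ← norm_neg ((A - B) * x)]
        simpa only [Matrix.sub_mul, neg_sub, add_sub_cancel]
          using norm_add_le (A * x) (-((A - B) * x))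

end Extremal

section Procrustes

open scoped MatrixOrder Matrix.Norms.Frobenius

variable {n : ℕ} {S₀ S : Matrix (Fin n) (Fin n) ℝ}

/-- The matrix `(S₀^{1/2} S S₀^{1/2})^{1/2}`, whose trace is the fidelity of `S` and `S₀`. -/
def fidelityRoot (S₀ S : Matrix (Fin n) (Fin n) ℝ) : Matrix (Fin n) (Fin n) ℝ :=
  msqrt (msqrt S₀ * S * msqrt S₀)

/-- The orthogonal polar factor of `S₀^{1/2} S^{1/2}`, which solves the Procrustes problem of
rotating `S₀^{1/2}` to `S^{1/2}`. It is the expected matrix only for positive definite arguments,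
where the inverse exists. -/
def procrustesRotation (S₀ S : Matrix (Fin n) (Fin n) ℝ) : Matrix (Fin n) (Fin n) ℝ :=
  (fidelityRoot S₀ S)⁻¹ * msqrt S₀ * msqrt S

/-- The optimal transport map `S₀^{1/2} (S₀^{1/2} S S₀^{1/2})^{-1/2} S₀^{1/2}` from the centred
Gaussian measure of covariance `S` to that of covariance `S₀`, for positive definite arguments. -/
def transportMap (S₀ S : Matrix (Fin n) (Fin n) ℝ) : Matrix (Fin n) (Fin n) ℝ :=
  msqrt S₀ * (fidelityRoot S₀ S)⁻¹ * msqrt S₀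

theorem posSemidef_fidelityRoot (S₀ S : Matrix (Fin n) (Fin n) ℝ) :
    (fidelityRoot S₀ S).PosSemidef :=
  posSemidef_msqrt _

theorem isSymm_fidelityRoot (S₀ S : Matrix (Fin n) (Fin n) ℝ) : (fidelityRoot S₀ S).IsSymm :=
  isSymm_msqrt _

theorem isSymm_transportMap (S₀ S : Matrix (Fin n) (Fin n) ℝ) : (transportMap S₀ S).IsSymm := by
  rw [IsSymm, transportMap, transpose_mul, transpose_mul, transpose_nonsing_inv,
    (isSymm_msqrt S₀).eq, (isSymm_fidelityRoot S₀ S).eq, Matrix.mul_assoc]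

theorem fidelityRoot_mul_self (S₀ : Matrix (Fin n) (Fin n) ℝ) (hS : S.PosSemidef) :
    fidelityRoot S₀ S * fidelityRoot S₀ S = msqrt S₀ * S * msqrt S₀ :=
  msqrt_mul_msqrt (posSemidef_mul_mul_of_isSymm hS (isSymm_msqrt S₀))

theorem posDef_fidelityRoot (hS₀ : S₀.PosDef) (hS : S.PosDef) : (fidelityRoot S₀ S).PosDef := by
  have h := hS.conjTranspose_mul_mul_same (B := msqrt S₀)
    (mulVec_injective_iff_isUnit.2 (posDef_msqrt hS₀).isUnit)
  rw [conjTranspose_eq_transpose_of_trivial, (isSymm_msqrt S₀).eq] at h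
  exact posDef_msqrt h

theorem isUnit_det_fidelityRoot (hS₀ : S₀.PosDef) (hS : S.PosDef) :
    IsUnit (fidelityRoot S₀ S).det :=
  (isUnit_iff_isUnit_det _).1 (posDef_fidelityRoot hS₀ hS).isUnit

theorem fidelityRoot_mul_procrustesRotation (hS₀ : S₀.PosDef) (hS : S.PosDef) :
    fidelityRoot S₀ S * procrustesRotation S₀ S = msqrt S₀ * msqrt S := by
  rw [procrustesRotation, Matrix.mul_assoc,
    mul_nonsing_inv_cancel_left _ _ (isUnit_det_fidelityRoot hS₀ hS)]

theorem procrustesRotation_mul_transpose (hS₀ : S₀.PosDef) (hS : S.PosDef) :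
    procrustesRotation S₀ S * (procrustesRotation S₀ S)ᵀ = 1 := by
  have hM := isUnit_det_fidelityRoot hS₀ hS
  calc procrustesRotation S₀ S * (procrustesRotation S₀ S)ᵀ
      = (fidelityRoot S₀ S)⁻¹ * (msqrt S₀ * (msqrt S * msqrt S) * msqrt S₀)
          * (fidelityRoot S₀ S)⁻¹ := by
        rw [procrustesRotation, transpose_mul, transpose_mul, transpose_nonsing_inv,
          (isSymm_msqrt S₀).eq, (isSymm_msqrt S).eq, (isSymm_fidelityRoot S₀ S).eq]
        simp only [Matrix.mul_assoc]
    _ = (fidelityRoot S₀ S)⁻¹ * (fidelityRoot S₀ S * fidelityRoot S₀ S)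
          * (fidelityRoot S₀ S)⁻¹ := by
        rw [msqrt_mul_msqrt hS.posSemidef, fidelityRoot_mul_self S₀ hS.posSemidef]
    _ = 1 := by rw [nonsing_inv_mul_cancel_left _ _ hM, mul_nonsing_inv _ hM]

theorem transportMap_mul_msqrt (S₀ S : Matrix (Fin n) (Fin n) ℝ) :
    transportMap S₀ S * msqrt S = msqrt S₀ * procrustesRotation S₀ S := by
  simp only [transportMap, procrustesRotation, Matrix.mul_assoc]

theorem bwLoss_eq (S₀ S : Matrix (Fin n) (Fin n) ℝ) :
    bwLoss S₀ S = S.trace + S₀.trace - 2 * (fidelityRoot S₀ S).trace := by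
  rw [bwLoss, trace_sub, trace_add, trace_smul, smul_eq_mul, fidelityRoot]

theorem norm_msqrt_sub_mul_sq (hS₀ : S₀.PosSemidef) (hS : S.PosSemidef)
    {V : Matrix (Fin n) (Fin n) ℝ} (hV : V * Vᵀ = 1) :
    ‖msqrt S - msqrt S₀ * V‖ ^ 2
      = S.trace + S₀.trace - 2 * (msqrt S₀ * msqrt S * Vᵀ).trace := by
  have hcross : (msqrt S * (Vᵀ * msqrt S₀)).trace = (msqrt S₀ * msqrt S * Vᵀ).trace := by
    rw [← Matrix.mul_assoc, trace_mul_comm, Matrix.mul_assoc]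
  have hcross' : (msqrt S₀ * V * msqrt S).trace = (msqrt S₀ * msqrt S * Vᵀ).trace := by
    rw [← hcross, ← trace_transpose]
    simp only [transpose_mul, (isSymm_msqrt S₀).eq, (isSymm_msqrt S).eq]
  have hrot : msqrt S₀ * V * (Vᵀ * msqrt S₀) = S₀ := by
    rw [Matrix.mul_assoc, ← Matrix.mul_assoc V, hV, Matrix.one_mul, msqrt_mul_msqrt hS₀]
  rw [norm_sq_eq_trace_mul_transpose, transpose_sub, transpose_mul, (isSymm_msqrt S).eq,
    (isSymm_msqrt S₀).eq, Matrix.sub_mul, Matrix.mul_sub, Matrix.mul_sub, msqrt_mul_msqrt hS, hrot]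
  simp only [trace_sub, hcross, hcross']
  ring

theorem bwLoss_le_norm_sq (hS₀ : S₀.PosDef) (hS : S.PosDef) {V : Matrix (Fin n) (Fin n) ℝ}
    (hV : V * Vᵀ = 1) : bwLoss S₀ S ≤ ‖msqrt S - msqrt S₀ * V‖ ^ 2 := by
  set U := procrustesRotation S₀ S
  have hUV : (U * Vᵀ) * (U * Vᵀ)ᵀ = 1 := by
    rw [transpose_mul, transpose_transpose, Matrix.mul_assoc, ← Matrix.mul_assoc Vᵀ,
      mul_eq_one_comm.1 hV, Matrix.one_mul, procrustesRotation_mul_transpose hS₀ hS]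
  have hpolar : (msqrt S₀ * msqrt S * Vᵀ).trace = (U * Vᵀ * fidelityRoot S₀ S).trace := by
    rw [← fidelityRoot_mul_procrustesRotation hS₀ hS, Matrix.mul_assoc, trace_mul_comm]
  have hle := trace_orthogonal_mul_le hUV (posSemidef_fidelityRoot S₀ S)
  rw [norm_msqrt_sub_mul_sq hS₀.posSemidef hS.posSemidef hV, bwLoss_eq, hpolar]
  linarith

theorem bwLoss_eq_norm_sq (hS₀ : S₀.PosDef) (hS : S.PosDef) :
    bwLoss S₀ S = ‖msqrt S - msqrt S₀ * procrustesRotation S₀ S‖ ^ 2 := by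
  have hU := procrustesRotation_mul_transpose hS₀ hS
  rw [norm_msqrt_sub_mul_sq hS₀.posSemidef hS.posSemidef hU,
    ← fidelityRoot_mul_procrustesRotation hS₀ hS, Matrix.mul_assoc, hU, Matrix.mul_one, bwLoss_eq]

theorem bwLoss_nonneg (hS₀ : S₀.PosDef) (hS : S.PosDef) : 0 ≤ bwLoss S₀ S :=
  bwLoss_eq_norm_sq hS₀ hS ▸ sq_nonneg _

theorem bwLoss_eq_trace (hS₀ : S₀.PosDef) (hS : S.PosDef) :
    bwLoss S₀ S = ((1 - transportMap S₀ S) * S * (1 - transportMap S₀ S)).trace := by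
  have hG : (1 - transportMap S₀ S).IsSymm := isSymm_one.sub (isSymm_transportMap S₀ S)
  have hfactor : msqrt S - transportMap S₀ S * msqrt S = (1 - transportMap S₀ S) * msqrt S := by
    rw [Matrix.sub_mul, Matrix.one_mul]
  rw [bwLoss_eq_norm_sq hS₀ hS, ← transportMap_mul_msqrt, hfactor,
    norm_sq_eq_trace_mul_transpose, transpose_mul, hG.eq, (isSymm_msqrt S).eq, Matrix.mul_assoc,
    ← Matrix.mul_assoc (msqrt S), msqrt_mul_msqrt hS.posSemidef, ← Matrix.mul_assoc]

theorem bwLoss_self (hS₀ : S₀.PosSemidef) : bwLoss S₀ S₀ = 0 := by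
  have hsq : msqrt S₀ * S₀ * msqrt S₀ = S₀ * S₀ := by
    have h := msqrt_mul_msqrt hS₀
    generalize msqrt S₀ = R at h
    rw [← h]
    noncomm_ring
  rw [bwLoss_eq, fidelityRoot, hsq, msqrt_mul_self hS₀]
  ring

theorem bwLoss_eq_zero_iff (hS₀ : S₀.PosDef) (hS : S.PosDef) : bwLoss S₀ S = 0 ↔ S = S₀ := by
  refine ⟨fun h => ?_, fun h => h ▸ bwLoss_self hS.posSemidef⟩
  rw [bwLoss_eq_norm_sq hS₀ hS, sq_eq_zero_iff, norm_eq_zero, sub_eq_zero] at h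
  calc S = msqrt S * (msqrt S)ᵀ := by rw [(isSymm_msqrt S).eq, msqrt_mul_msqrt hS.posSemidef]
    _ = msqrt S₀ * (msqrt S₀)ᵀ := by
        rw [h, transpose_mul, Matrix.mul_assoc, ← Matrix.mul_assoc (procrustesRotation S₀ S),
          procrustesRotation_mul_transpose hS₀ hS, Matrix.one_mul]
    _ = S₀ := by rw [(isSymm_msqrt S₀).eq, msqrt_mul_msqrt hS₀.posSemidef]

theorem eq_target_of_isMinOn (hS₀ : S₀.PosDef) (hS : S.PosDef)
    (hmin : IsMinOn (bwLoss S₀) {S | S.PosDef} S) : S = S₀ := by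
  have hle : bwLoss S₀ S ≤ bwLoss S₀ S₀ := hmin hS₀
  rw [bwLoss_self hS₀.posSemidef] at hle
  exact (bwLoss_eq_zero_iff hS₀ hS).1 (hle.antisymm (bwLoss_nonneg hS₀ hS))

theorem iInf_frobNorm_eq_sqrt_bwLoss (hS₀ : S₀.PosDef) (hS : S.PosDef) :
    ⨅ U : orthogonalGroup (Fin n) ℝ,
      frobNorm (msqrt S - msqrt S₀ * (U : Matrix (Fin n) (Fin n) ℝ)) = √(bwLoss S₀ S) := by
  simp only [frobNorm_eq_norm]
  refine le_antisymm ?_ (le_ciInf fun U => ?_)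
  · rw [bwLoss_eq_norm_sq hS₀ hS, Real.sqrt_sq (norm_nonneg _)]
    exact ciInf_le ⟨0, Set.forall_mem_range.2 fun _ => norm_nonneg _⟩
      (⟨procrustesRotation S₀ S, (mem_orthogonalGroup_iff _ _).2
        (procrustesRotation_mul_transpose hS₀ hS)⟩ : orthogonalGroup (Fin n) ℝ)
  · exact Real.sqrt_le_iff.2
      ⟨norm_nonneg _, bwLoss_le_norm_sq hS₀ hS ((mem_orthogonalGroup_iff _ _).1 U.2)⟩

theorem hasModifiedDeficiencyMargin_iff (hS₀ : S₀.PosDef) (hS : S.PosDef) {c : ℝ} :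
    HasModifiedDeficiencyMargin S₀ S c ↔ √(bwLoss S₀ S) ≤ sigmaMin (msqrt S₀) - c := by
  rw [HasModifiedDeficiencyMargin, iInf_frobNorm_eq_sqrt_bwLoss hS₀ hS]

namespace HasModifiedDeficiencyMargin

variable {c : ℝ}

theorem le_sigmaMin_target (h : HasModifiedDeficiencyMargin S₀ S c) :
    c ≤ sigmaMin (msqrt S₀) := by
  have hnonneg : 0 ≤ ⨅ U : orthogonalGroup (Fin n) ℝ,
      frobNorm (msqrt S - msqrt S₀ * (U : Matrix (Fin n) (Fin n) ℝ)) :=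
    Real.iInf_nonneg fun _ => Real.sqrt_nonneg _
  linarith [hnonneg.trans h]

theorem of_bwLoss_le (h : HasModifiedDeficiencyMargin S₀ S c) (hS₀ : S₀.PosDef) (hS : S.PosDef)
    {S' : Matrix (Fin n) (Fin n) ℝ} (hS' : S'.PosDef) (hle : bwLoss S₀ S' ≤ bwLoss S₀ S) :
    HasModifiedDeficiencyMargin S₀ S' c := by
  rw [hasModifiedDeficiencyMargin_iff hS₀ hS] at h
  exact (hasModifiedDeficiencyMargin_iff hS₀ hS').2 ((Real.sqrt_le_sqrt hle).trans h)

variable [NeZero n]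

theorem le_sigmaMin (h : HasModifiedDeficiencyMargin S₀ S c) : c ≤ sigmaMin (msqrt S) := by
  have hweyl : sigmaMin (msqrt S₀) - sigmaMin (msqrt S) ≤ ⨅ U : orthogonalGroup (Fin n) ℝ,
      frobNorm (msqrt S - msqrt S₀ * (U : Matrix (Fin n) (Fin n) ℝ)) := by
    refine le_ciInf fun U => ?_
    have hU := sigmaMin_sub_norm_le (msqrt S) (msqrt S₀ * (U : Matrix (Fin n) (Fin n) ℝ))
    rw [sigmaMin_mul_orthogonal] at hU
    rw [frobNorm_eq_norm]
    linarith
  linarith [hweyl.trans h]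

theorem sq_le_lambdaMin (h : HasModifiedDeficiencyMargin S₀ S c) (hc : 0 ≤ c)
    (hS : S.PosSemidef) : c ^ 2 ≤ lambdaMin S :=
  sigmaMin_msqrt_sq hS ▸ pow_le_pow_left₀ hc h.le_sigmaMin 2

theorem sq_le_lambdaMin_target (h : HasModifiedDeficiencyMargin S₀ S c) (hc : 0 ≤ c)
    (hS₀ : S₀.PosSemidef) : c ^ 2 ≤ lambdaMin S₀ :=
  sigmaMin_msqrt_sq hS₀ ▸ pow_le_pow_left₀ hc h.le_sigmaMin_target 2

theorem posDef (h : HasModifiedDeficiencyMargin S₀ S c) (hc : 0 < c) (hS : S.PosSemidef) :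
    S.PosDef :=
  posDef_of_smul_one_le (pow_pos hc 2)
    ((le_lambdaMin_iff hS.isHermitian).1 (h.sq_le_lambdaMin hc.le hS))

theorem posDef_target (h : HasModifiedDeficiencyMargin S₀ S c) (hc : 0 < c)
    (hS₀ : S₀.PosSemidef) : S₀.PosDef :=
  posDef_of_smul_one_le (pow_pos hc 2)
    ((le_lambdaMin_iff hS₀.isHermitian).1 (h.sq_le_lambdaMin_target hc.le hS₀))

end HasModifiedDeficiencyMargin

theorem sigmaMin_smul_one_le_msqrt [NeZero n] (hS : S.PosSemidef) :
    sigmaMin (msqrt S) • 1 ≤ msqrt S := by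
  refine smul_one_le_of_pow (posSemidef_msqrt S) two_ne_zero ?_
  rw [sigmaMin_msqrt_sq hS, sq, msqrt_mul_msqrt hS]
  exact lambdaMin_smul_one_le hS.isHermitian

theorem HasModifiedDeficiencyMargin.bwLoss_le_frobNorm_sub [NeZero n] {c : ℝ}
    (h : HasModifiedDeficiencyMargin S₀ S c) (hc : 0 ≤ c) (hS₀ : S₀.PosDef) (hS : S.PosDef) :
    bwLoss S₀ S ≤ frobNorm (S - S₀) := by
  set σ := sigmaMin (msqrt S₀)
  have hσ : 0 ≤ σ := Real.sqrt_nonneg _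
  have hroot : √(bwLoss S₀ S) ≤ σ := by
    linarith [(hasModifiedDeficiencyMargin_iff hS₀ hS).1 h]
  have hdiff : √(bwLoss S₀ S) ≤ ‖msqrt S₀ - msqrt S‖ := by
    rw [norm_sub_rev]
    refine Real.sqrt_le_iff.2 ⟨norm_nonneg _, ?_⟩
    simpa only [Matrix.mul_one] using bwLoss_le_norm_sq hS₀ hS (V := 1) (by simp)
  calc bwLoss S₀ S = √(bwLoss S₀ S) * √(bwLoss S₀ S) :=
        (Real.mul_self_sqrt (bwLoss_nonneg hS₀ hS)).symm
    _ ≤ σ * ‖msqrt S₀ - msqrt S‖ := by gcongr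
    _ ≤ ‖msqrt S₀ * msqrt S₀ - msqrt S * msqrt S‖ :=
        mul_norm_sub_le_norm_mul_self_sub hσ (sigmaMin_smul_one_le_msqrt hS₀.posSemidef)
          (posSemidef_msqrt S)
    _ = frobNorm (S - S₀) := by
        rw [msqrt_mul_msqrt hS₀.posSemidef, msqrt_mul_msqrt hS.posSemidef, norm_sub_rev,
          frobNorm_eq_norm]

end Procrustes

section LossDerivative

open scoped MatrixOrder Matrix.Norms.Frobenius

section Continuous

variable {ι κ μ : Type*} [Fintype ι] [Fintype κ] [Fintype μ]

/-- The functional `H ↦ tr (Zᵀ H)` represented by `Z` in the Frobenius inner product. -/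
def frobDual (Z : Matrix ι κ ℝ) : Matrix ι κ ℝ →L[ℝ] ℝ :=
  LinearMap.toContinuousLinearMap (traceLinearMap κ ℝ ℝ ∘ₗ mulLeftLinearMap κ ℝ Zᵀ)

variable (ι κ μ) in
/-- Matrix multiplication as a continuous bilinear map. -/
def mulCLM : Matrix ι κ ℝ →L[ℝ] Matrix κ μ ℝ →L[ℝ] Matrix ι μ ℝ :=
  LinearMap.mkContinuous₂ (mulLinearMap ℝ) 1 fun A B => by
    rw [one_mul]; exact frobenius_norm_mul A B

variable (ι κ) in
/-- Transposition as a continuous linear map. -/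
def transposeCLM : Matrix ι κ ℝ →L[ℝ] Matrix κ ι ℝ :=
  LinearMap.toContinuousLinearMap (transposeLinearEquiv ι κ ℝ ℝ).toLinearMap

theorem hasFDerivAt_mul_transpose (A : Matrix ι κ ℝ) :
    HasFDerivAt (fun A : Matrix ι κ ℝ => A * Aᵀ)
      ((mulCLM ι κ ι).precompR _ A (transposeCLM ι κ)
        + (mulCLM ι κ ι).precompL _ (.id ℝ _) Aᵀ) A :=
  (mulCLM ι κ ι).hasFDerivAt_of_bilinear (hasFDerivAt_id A) (transposeCLM ι κ).hasFDerivAt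

theorem smul_inv_le_one [DecidableEq ι] {M : Matrix ι ι ℝ} (hM : M.PosDef) {s : ℝ}
    (h : s • 1 ≤ M) : s • M⁻¹ ≤ 1 := by
  have hdet : IsUnit M.det := (isUnit_iff_isUnit_det _).1 hM.isUnit
  have hcomm : Commute M⁻¹ (M - s • 1) := by
    refine Commute.sub_right ?_ ((Commute.one_right _).smul_right _)
    rw [Commute, SemiconjBy, nonsing_inv_mul _ hdet, mul_nonsing_inv _ hdet]
  have hmul := hcomm.mul_nonneg hM.inv.posSemidef.nonneg (sub_nonneg.2 h)
  rwa [Matrix.mul_sub, nonsing_inv_mul _ hdet, Matrix.mul_smul, Matrix.mul_one, sub_nonneg] at hmul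

theorem mul_trace_conj_inv_le [DecidableEq ι] {M D : Matrix ι ι ℝ} (hM : M.PosDef)
    (hD : D.IsSymm) {s : ℝ} (h : s • 1 ≤ M) : s * (D * M⁻¹ * D).trace ≤ ‖D‖ ^ 2 := by
  have hDD : (D * D).PosSemidef := by simpa only [hD.eq] using posSemidef_mul_transpose_self D
  calc s * (D * M⁻¹ * D).trace = (s • M⁻¹ * (D * D)).trace := by
        rw [Matrix.smul_mul, trace_smul, smul_eq_mul, trace_mul_comm M⁻¹, trace_mul_comm (D * M⁻¹),
          Matrix.mul_assoc]
    _ ≤ (1 * (D * D)).trace := trace_mul_le_trace_mul_right (smul_inv_le_one hM h) hDD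
    _ = ‖D‖ ^ 2 := by rw [Matrix.one_mul, norm_sq_eq_trace, hD.eq]

end Continuous

variable {n : ℕ} {S₀ S S' : Matrix (Fin n) (Fin n) ℝ}

theorem trace_transportMap_mul (S₀ S S' : Matrix (Fin n) (Fin n) ℝ) :
    (transportMap S₀ S * S').trace
      = ((fidelityRoot S₀ S)⁻¹ * (msqrt S₀ * S' * msqrt S₀)).trace := by
  rw [transportMap, Matrix.mul_assoc, Matrix.mul_assoc, trace_mul_comm]
  simp only [Matrix.mul_assoc]

/-- Since `tr (Γ S') = tr (M⁻¹ M'²)` for the transport map `Γ` and the roots `M`, `M'`, the second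
order remainder of the loss is an explicit quadratic form in `M - M'`. -/
theorem bwLoss_sub_sub_trace (hS₀ : S₀.PosDef) (hS : S.PosDef) (hS' : S'.PosSemidef) :
    bwLoss S₀ S' - bwLoss S₀ S - ((1 - transportMap S₀ S) * (S' - S)).trace
      = ((fidelityRoot S₀ S - fidelityRoot S₀ S') * (fidelityRoot S₀ S)⁻¹
          * (fidelityRoot S₀ S - fidelityRoot S₀ S')).trace := by
  have hdet := isUnit_det_fidelityRoot hS₀ hS
  have hΓS : (transportMap S₀ S * S).trace = (fidelityRoot S₀ S).trace := by
    rw [trace_transportMap_mul, ← fidelityRoot_mul_self S₀ hS.posSemidef,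
      nonsing_inv_mul_cancel_left _ _ hdet]
  have hΓS' : (transportMap S₀ S * S').trace
      = (fidelityRoot S₀ S' * (fidelityRoot S₀ S)⁻¹ * fidelityRoot S₀ S').trace := by
    rw [trace_transportMap_mul, ← fidelityRoot_mul_self S₀ hS', ← Matrix.mul_assoc,
      trace_mul_comm, Matrix.mul_assoc]
  have hexpand : (fidelityRoot S₀ S - fidelityRoot S₀ S') * (fidelityRoot S₀ S)⁻¹
        * (fidelityRoot S₀ S - fidelityRoot S₀ S')
      = fidelityRoot S₀ S - fidelityRoot S₀ S' - fidelityRoot S₀ S'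
        + fidelityRoot S₀ S' * (fidelityRoot S₀ S)⁻¹ * fidelityRoot S₀ S' := by
    rw [Matrix.sub_mul, mul_nonsing_inv _ hdet, Matrix.mul_sub, Matrix.sub_mul,
      nonsing_inv_mul_cancel_right _ _ hdet, Matrix.sub_mul, Matrix.one_mul, Matrix.one_mul]
    abel
  rw [hexpand]
  simp only [bwLoss_eq, Matrix.sub_mul, Matrix.one_mul, Matrix.mul_sub, trace_add, trace_sub,
    hΓS, hΓS']
  ring

theorem norm_fidelityRoot_sub_le (hS : S.PosSemidef) (hS' : S'.PosSemidef) {s : ℝ} (hs : 0 ≤ s)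
    (h : s • 1 ≤ fidelityRoot S₀ S) :
    s * ‖fidelityRoot S₀ S - fidelityRoot S₀ S'‖ ≤ ‖msqrt S₀‖ ^ 2 * ‖S' - S‖ := by
  have hdiff : fidelityRoot S₀ S * fidelityRoot S₀ S - fidelityRoot S₀ S' * fidelityRoot S₀ S'
      = msqrt S₀ * (S - S') * msqrt S₀ := by
    rw [fidelityRoot_mul_self S₀ hS, fidelityRoot_mul_self S₀ hS', Matrix.mul_sub,
      Matrix.sub_mul]
  calc s * ‖fidelityRoot S₀ S - fidelityRoot S₀ S'‖ ≤ ‖msqrt S₀ * (S - S') * msqrt S₀‖ :=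
        hdiff ▸ mul_norm_sub_le_norm_mul_self_sub hs h (posSemidef_fidelityRoot S₀ S')
    _ ≤ ‖msqrt S₀‖ * ‖S - S'‖ * ‖msqrt S₀‖ :=
        (frobenius_norm_mul _ _).trans (by gcongr; exact frobenius_norm_mul _ _)
    _ = ‖msqrt S₀‖ ^ 2 * ‖S' - S‖ := by rw [norm_sub_rev]; ring

theorem exists_norm_bwLoss_sub_sub_trace_le [NeZero n] (hS₀ : S₀.PosDef) (hS : S.PosDef) :
    ∃ C : ℝ, ∀ S' : Matrix (Fin n) (Fin n) ℝ, S'.PosSemidef →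
      ‖bwLoss S₀ S' - bwLoss S₀ S - ((1 - transportMap S₀ S) * (S' - S)).trace‖
        ≤ C * ‖S' - S‖ ^ 2 := by
  have hM := posDef_fidelityRoot hS₀ hS
  set s := lambdaMin (fidelityRoot S₀ S)
  have hs : 0 < s := lambdaMin_pos hM
  have hsM : s • 1 ≤ fidelityRoot S₀ S := lambdaMin_smul_one_le hM.isHermitian
  refine ⟨(‖msqrt S₀‖ ^ 2) ^ 2 / s ^ 3, fun S' hS' => ?_⟩
  have hD : (fidelityRoot S₀ S - fidelityRoot S₀ S').IsSymm :=
    (isSymm_fidelityRoot S₀ S).sub (isSymm_fidelityRoot S₀ S')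
  have hnonneg : 0 ≤ ((fidelityRoot S₀ S - fidelityRoot S₀ S') * (fidelityRoot S₀ S)⁻¹
      * (fidelityRoot S₀ S - fidelityRoot S₀ S')).trace :=
    (posSemidef_mul_mul_of_isSymm hM.inv.posSemidef hD).trace_nonneg
  rw [bwLoss_sub_sub_trace hS₀ hS hS', Real.norm_of_nonneg hnonneg, div_mul_eq_mul_div,
    le_div_iff₀ (by positivity)]
  calc _ = s ^ 2 * (s * ((fidelityRoot S₀ S - fidelityRoot S₀ S') * (fidelityRoot S₀ S)⁻¹
          * (fidelityRoot S₀ S - fidelityRoot S₀ S')).trace) := by ring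
    _ ≤ s ^ 2 * ‖fidelityRoot S₀ S - fidelityRoot S₀ S'‖ ^ 2 := by
        gcongr; exact mul_trace_conj_inv_le hM hD hsM
    _ = (s * ‖fidelityRoot S₀ S - fidelityRoot S₀ S'‖) ^ 2 := by ring
    _ ≤ (‖msqrt S₀‖ ^ 2 * ‖S' - S‖) ^ 2 := by
        gcongr ?_ ^ 2; exact norm_fidelityRoot_sub_le hS.posSemidef hS' hs.le hsM
    _ = (‖msqrt S₀‖ ^ 2) ^ 2 * ‖S' - S‖ ^ 2 := by ring

theorem hasFDerivWithinAt_bwLoss [NeZero n] (hS₀ : S₀.PosDef) (hS : S.PosDef) :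
    HasFDerivWithinAt (bwLoss S₀) (frobDual (1 - transportMap S₀ S)) {S | S.PosSemidef} S := by
  obtain ⟨C, hC⟩ := exists_norm_bwLoss_sub_sub_trace_le hS₀ hS
  have hG : (1 - transportMap S₀ S).IsSymm := isSymm_one.sub (isSymm_transportMap S₀ S)
  refine .of_isLittleO (Asymptotics.IsBigO.trans_isLittleO (.of_bound C ?_)
    ((Asymptotics.isLittleO_pow_sub_sub S one_lt_two).mono nhdsWithin_le_nhds))
  filter_upwards [self_mem_nhdsWithin] with S' hS'
  rw [norm_pow, norm_norm]
  change ‖_ - _ - ((1 - transportMap S₀ S)ᵀ * (S' - S)).trace‖ ≤ _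
  rw [hG.eq]
  exact hC S' hS'

theorem hasFDerivAt_bwLoss_mul_transpose [NeZero n] {κ : Type*} [Fintype κ] (hS₀ : S₀.PosDef)
    {E : Matrix (Fin n) κ ℝ} (hE : (E * Eᵀ).PosDef) :
    HasFDerivAt (fun E : Matrix (Fin n) κ ℝ => bwLoss S₀ (E * Eᵀ))
      (frobDual ((2 : ℝ) • ((1 - transportMap S₀ (E * Eᵀ)) * E))) E := by
  have hG : (1 - transportMap S₀ (E * Eᵀ)).IsSymm := isSymm_one.sub (isSymm_transportMap S₀ _)
  refine ((hasFDerivWithinAt_bwLoss hS₀ hE).comp_hasFDerivAt E (hasFDerivAt_mul_transpose E)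
    (.of_forall fun E' => posSemidef_mul_transpose_self E')).congr_fderiv ?_
  ext H
  set G := 1 - transportMap S₀ (E * Eᵀ)
  have hcross : (G * (E * Hᵀ)).trace = (G * (H * Eᵀ)).trace := by
    rw [← trace_transpose, trace_mul_comm G]
    simp only [transpose_mul, transpose_transpose, hG.eq]
  change (Gᵀ * (E * Hᵀ + H * Eᵀ)).trace = (((2 : ℝ) • (G * E))ᵀ * H).trace
  rw [transpose_smul, transpose_mul, hG.eq, Matrix.smul_mul, trace_smul, Matrix.mul_add, trace_add,
    hcross, smul_eq_mul, Matrix.mul_assoc Eᵀ, trace_mul_comm Eᵀ, Matrix.mul_assoc]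
  ring

end LossDerivative

section Network

open scoped MatrixOrder Matrix.Norms.Frobenius

variable {N : ℕ} {d : ℕ → ℕ}

/-- The partial product `W_N ⋯ W_{k+1}`, for `k ≤ N` (the identity if `k = N`). -/
def suffixProd (W : Params N d) (k : ℕ) (hk : k ≤ N) : Matrix (Fin (d N)) (Fin (d k)) ℝ :=
  Nat.decreasingInduction (motive := fun k _ => Matrix (Fin (d N)) (Fin (d k)) ℝ)
    (fun k h U => U * layer W k h) 1 hk

theorem suffixProd_self (W : Params N d) : suffixProd W N le_rfl = 1 :=
  Nat.decreasingInduction_self _ _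

theorem suffixProd_eq_mul (W : Params N d) (k : ℕ) (hk : k < N) :
    suffixProd W k hk.le = suffixProd W (k + 1) hk * layer W k hk :=
  Nat.decreasingInduction_succ_left _ _ _ _

theorem partialProd_succ (W : Params N d) (k : ℕ) (hk : k < N) :
    partialProd W (k + 1) hk = layer W k hk * partialProd W k hk.le := rfl

theorem suffixProd_mul_partialProd (W : Params N d) (k : ℕ) (hk : k ≤ N) :
    suffixProd W k hk * partialProd W k hk = endToEnd W := by
  induction hk using Nat.decreasingInduction with
  | self => rw [suffixProd_self, Matrix.one_mul, endToEnd]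
  | of_succ k hk ih => rw [suffixProd_eq_mul W k hk, Matrix.mul_assoc, ← partialProd_succ, ih]

theorem suffixProd_zero (W : Params N d) : suffixProd W 0 N.zero_le = endToEnd W := by
  rw [← suffixProd_mul_partialProd W 0 N.zero_le, partialProd, Matrix.mul_one]

theorem posSemidef_covariance (W : Params N d) : (covariance W).PosSemidef :=
  posSemidef_mul_transpose_self _

section Gradient

/-- The component at layer `k` of the gradient of `W ↦ f (W_N ⋯ W_1)`, where `Z` is the gradient
of `f` at `W_N ⋯ W_1`. -/
def layerGrad (W : Params N d) (Z : Matrix (Fin (d N)) (Fin (d 0)) ℝ) (k : ℕ) (hk : k < N) :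
    Matrix (Fin (d (k + 1))) (Fin (d k)) ℝ :=
  (suffixProd W (k + 1) hk)ᵀ * Z * (partialProd W k hk.le)ᵀ

/-- The gradient of `W ↦ f (W_N ⋯ W_1)`, where `Z` is the gradient of `f` at `W_N ⋯ W_1`. -/
def paramGrad (W : Params N d) (Z : Matrix (Fin (d N)) (Fin (d 0)) ℝ) : Params N d :=
  WithLp.toLp 2 fun j => WithLp.toLp 2 fun p => layerGrad W Z j.1 j.2 p.1 p.2

theorem layer_paramGrad (W : Params N d) (Z : Matrix (Fin (d N)) (Fin (d 0)) ℝ) (k : ℕ)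
    (hk : k < N) : layer (paramGrad W Z) k hk = layerGrad W Z k hk := rfl

theorem inner_eq_sum_trace (V W : Params N d) :
    inner ℝ V W = ∑ j : Fin N, ((layer V j.1 j.2)ᵀ * layer W j.1 j.2).trace := by
  rw [PiLp.inner_apply]
  refine Finset.sum_congr rfl fun j _ => ?_
  rw [PiLp.inner_apply, Fintype.sum_prod_type, trace_transpose_mul_eq_sum]
  simp only [layer, of_apply, RCLike.inner_apply, conj_trivial, mul_comm]

theorem norm_sq_eq_sum_norm_layer_sq (W : Params N d) :
    ‖W‖ ^ 2 = ∑ j : Fin N, ‖layer W j.1 j.2‖ ^ 2 := by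
  simp only [← real_inner_self_eq_norm_sq W, inner_eq_sum_trace, norm_sq_eq_trace]

theorem norm_paramGrad_sq (W : Params N d) (Z : Matrix (Fin (d N)) (Fin (d 0)) ℝ) :
    ‖paramGrad W Z‖ ^ 2 = ∑ j : Fin N, ‖layerGrad W Z j.1 j.2‖ ^ 2 := by
  simp only [norm_sq_eq_sum_norm_layer_sq, layer_paramGrad]

/-- The weight matrix `layer W k hk` as a continuous linear function of `W`. -/
def layerCLM (k : ℕ) (hk : k < N) : Params N d →L[ℝ] Matrix (Fin (d (k + 1))) (Fin (d k)) ℝ :=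
  LinearMap.toContinuousLinearMap
    { toFun := fun W => layer W k hk
      map_add' := fun _ _ => rfl
      map_smul' := fun _ _ => rfl }

/-- The derivative of `W ↦ partialProd W k hk`, given by the product rule. -/
def partialProdDeriv (W : Params N d) :
    (k : ℕ) → k ≤ N → Params N d →L[ℝ] Matrix (Fin (d k)) (Fin (d 0)) ℝ
  | 0, _ => 0
  | k + 1, h =>
    (mulCLM _ _ _).precompR _ (layer W k h) (partialProdDeriv W k (Nat.le_of_succ_le h))
      + (mulCLM _ _ _).precompL _ (layerCLM k h) (partialProd W k (Nat.le_of_succ_le h))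

theorem hasFDerivAt_partialProd (W : Params N d) (k : ℕ) (hk : k ≤ N) :
    HasFDerivAt (fun W : Params N d => partialProd W k hk) (partialProdDeriv W k hk) W := by
  induction k with
  | zero => exact hasFDerivAt_const _ _
  | succ k ih => exact (mulCLM _ _ _).hasFDerivAt_of_bilinear (layerCLM k hk).hasFDerivAt (ih _)

theorem trace_mul_suffixProd_mul_partialProdDeriv (W V : Params N d)
    (Z : Matrix (Fin (d N)) (Fin (d 0)) ℝ) (k : ℕ) (hk : k ≤ N) :
    (Zᵀ * (suffixProd W k hk * partialProdDeriv W k hk V)).trace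
      = ∑ j : Fin k, ((layerGrad W Z j.1 (j.2.trans_le hk))ᵀ
          * layer V j.1 (j.2.trans_le hk)).trace := by
  induction k with
  | zero =>
    have hzero : partialProdDeriv W 0 hk V = 0 := rfl
    rw [hzero, Matrix.mul_zero, Matrix.mul_zero, trace_zero, Fin.sum_univ_zero]
  | succ k ih =>
    have hproductRule : partialProdDeriv W (k + 1) hk V
        = layer W k hk * partialProdDeriv W k (Nat.le_of_succ_le hk) V
          + layer V k hk * partialProd W k (Nat.le_of_succ_le hk) := rfl
    have hlast : ((layerGrad W Z k hk)ᵀ * layer V k hk).trace = (Zᵀ * (suffixProd W (k + 1) hk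
        * (layer V k hk * partialProd W k (Nat.le_of_succ_le hk)))).trace := by
      simp only [layerGrad, transpose_mul, transpose_transpose, Matrix.mul_assoc]
      rw [trace_mul_comm]
      simp only [Matrix.mul_assoc]
    rw [Fin.sum_univ_castSucc]
    simp only [Fin.val_castSucc, Fin.val_last]
    rw [← ih (Nat.le_of_succ_le hk), hlast, hproductRule, suffixProd_eq_mul W k hk,
      Matrix.mul_add, Matrix.mul_add, trace_add, Matrix.mul_assoc (suffixProd W (k + 1) hk)]

theorem hasGradientAt_comp_endToEnd {f : Matrix (Fin (d N)) (Fin (d 0)) ℝ → ℝ} {W : Params N d}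
    {Z : Matrix (Fin (d N)) (Fin (d 0)) ℝ} (hf : HasFDerivAt f (frobDual Z) (endToEnd W)) :
    HasGradientAt (fun W => f (endToEnd W)) (paramGrad W Z) W := by
  rw [hasGradientAt_iff_hasFDerivAt]
  refine (hf.comp W (hasFDerivAt_partialProd W N le_rfl)).congr_fderiv ?_
  ext V
  have h := trace_mul_suffixProd_mul_partialProdDeriv W V Z N le_rfl
  rw [suffixProd_self, Matrix.one_mul] at h
  exact h.trans (inner_eq_sum_trace (paramGrad W Z) V).symm

theorem hasGradientAt_paramLoss [NeZero (d N)] {S₀ : Matrix (Fin (d N)) (Fin (d N)) ℝ}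
    (hS₀ : S₀.PosDef) {W : Params N d} (hW : (covariance W).PosDef) :
    HasGradientAt (paramLoss S₀)
      (paramGrad W ((2 : ℝ) • ((1 - transportMap S₀ (covariance W)) * endToEnd W))) W :=
  hasGradientAt_comp_endToEnd (hasFDerivAt_bwLoss_mul_transpose hS₀ hW)

end Gradient

section Balanced

theorem mul_transpose_mul_self_pow {ι κ : Type*} [Fintype ι] [Fintype κ] [DecidableEq ι]
    [DecidableEq κ] (B : Matrix ι κ ℝ) (j : ℕ) : B * (Bᵀ * B) ^ j = (B * Bᵀ) ^ j * B := by
  induction j with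
  | zero => simp only [pow_zero, Matrix.mul_one, Matrix.one_mul]
  | succ j ih => rw [pow_succ, ← Matrix.mul_assoc, ih, pow_succ]; simp only [Matrix.mul_assoc]

/-- The Gram matrix `W_N W_Nᵀ` of the last layer (of `W_N ⋯ W_{N-1+1}`, the truncated subtraction
leaving the identity if `N = 0`). -/
def outerGram (W : Params N d) : Matrix (Fin (d N)) (Fin (d N)) ℝ :=
  suffixProd W (N - 1) N.pred_le * (suffixProd W (N - 1) N.pred_le)ᵀ

theorem posSemidef_outerGram (W : Params N d) : (outerGram W).PosSemidef :=
  posSemidef_mul_transpose_self _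

variable {W : Params N d}

theorem Balanced.partialProd_mul_transpose (hW : Balanced W) (k : ℕ) (hk : k < N) :
    partialProd W k hk.le * (partialProd W k hk.le)ᵀ = ((layer W k hk)ᵀ * layer W k hk) ^ k := by
  induction k with
  | zero => simp only [partialProd, transpose_one, Matrix.mul_one, pow_zero]
  | succ k ih =>
    have hk' := Nat.lt_of_succ_lt hk
    calc partialProd W (k + 1) hk.le * (partialProd W (k + 1) hk.le)ᵀ
        = layer W k hk' * (partialProd W k hk'.le * (partialProd W k hk'.le)ᵀ)
            * (layer W k hk')ᵀ := by
          rw [partialProd_succ W k hk', transpose_mul]; simp only [Matrix.mul_assoc]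
      _ = (layer W k hk' * (layer W k hk')ᵀ) ^ (k + 1) := by
          rw [ih hk', mul_transpose_mul_self_pow, Matrix.mul_assoc, ← pow_succ]
      _ = _ := by rw [hW k hk]

theorem Balanced.suffixProd_mul_gram (hW : Balanced W) (k : ℕ) (hk : k < N) :
    suffixProd W k hk.le * ((layer W k hk)ᵀ * layer W k hk)
      = outerGram W * suffixProd W k hk.le := by
  obtain ⟨M, rfl⟩ := Nat.exists_eq_add_one_of_ne_zero hk.ne_bot
  induction Nat.le_of_lt_succ hk using Nat.decreasingInduction with
  | self =>
    have hlast : suffixProd W M M.le_succ = layer W M M.lt_succ_self := by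
      rw [suffixProd_eq_mul W M M.lt_succ_self, suffixProd_self, Matrix.one_mul]
    change _ = suffixProd W M M.le_succ * (suffixProd W M M.le_succ)ᵀ * suffixProd W M M.le_succ
    rw [hlast, Matrix.mul_assoc]
  | of_succ k hkM ih =>
    have hk' : k + 1 < M + 1 := Nat.succ_lt_succ hkM
    calc suffixProd W k hk.le * ((layer W k hk)ᵀ * layer W k hk)
        = suffixProd W (k + 1) hk * (layer W k hk * (layer W k hk)ᵀ) * layer W k hk := by
          rw [suffixProd_eq_mul W k hk]; simp only [Matrix.mul_assoc]
      _ = outerGram W * suffixProd W (k + 1) hk * layer W k hk := by rw [hW k hk', ih hk']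
      _ = outerGram W * suffixProd W k hk.le := by
          rw [Matrix.mul_assoc, ← suffixProd_eq_mul W k hk]

theorem Balanced.suffixProd_mul_gram_pow (hW : Balanced W) (k : ℕ) (hk : k < N) (j : ℕ) :
    suffixProd W k hk.le * ((layer W k hk)ᵀ * layer W k hk) ^ j
      = outerGram W ^ j * suffixProd W k hk.le := by
  induction j with
  | zero => rw [pow_zero, pow_zero, Matrix.mul_one, Matrix.one_mul]
  | succ j ih =>
    rw [pow_succ, ← Matrix.mul_assoc, ih, Matrix.mul_assoc, hW.suffixProd_mul_gram, pow_succ,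
      Matrix.mul_assoc]

theorem Balanced.suffixProd_mul_transpose (hW : Balanced W) (k : ℕ) (hk : k ≤ N) :
    suffixProd W k hk * (suffixProd W k hk)ᵀ = outerGram W ^ (N - k) := by
  induction hk using Nat.decreasingInduction with
  | self => rw [suffixProd_self, transpose_one, Matrix.mul_one, Nat.sub_self, pow_zero]
  | of_succ k hk ih =>
    rcases (Nat.succ_le_of_lt hk).eq_or_lt with rfl | hk'
    · have hone : k.succ - k = 1 := Nat.add_sub_cancel_left k 1
      rw [hone, pow_one]; rfl
    · calc suffixProd W k hk.le * (suffixProd W k hk.le)ᵀ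
          = suffixProd W (k + 1) hk * (layer W k hk * (layer W k hk)ᵀ)
              * (suffixProd W (k + 1) hk)ᵀ := by
            rw [suffixProd_eq_mul W k hk, transpose_mul]; simp only [Matrix.mul_assoc]
        _ = outerGram W * outerGram W ^ (N - (k + 1)) := by
            rw [hW k hk', hW.suffixProd_mul_gram (k + 1) hk', Matrix.mul_assoc, ih]
        _ = outerGram W ^ (N - k) := by
            rw [← pow_succ', Nat.sub_add_eq, Nat.sub_add_cancel (by omega)]

theorem Balanced.covariance_eq_pow (hW : Balanced W) : covariance W = outerGram W ^ N := by
  rw [covariance, ← suffixProd_zero, hW.suffixProd_mul_transpose, Nat.sub_zero]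

theorem Balanced.endToEnd_mul_transpose_partialProd (hW : Balanced W) (k : ℕ) (hk : k < N) :
    endToEnd W * (partialProd W k hk.le)ᵀ = outerGram W ^ k * suffixProd W k hk.le := by
  rw [← suffixProd_mul_partialProd W k hk.le, Matrix.mul_assoc,
    hW.partialProd_mul_transpose k hk, hW.suffixProd_mul_gram_pow]

theorem Balanced.norm_layerGrad_sq (hW : Balanced W) {G : Matrix (Fin (d N)) (Fin (d N)) ℝ}
    (hG : G.IsSymm) (k : ℕ) (hk : k < N) :
    ‖layerGrad W (G * endToEnd W) k hk‖ ^ 2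
      = (G * outerGram W ^ (N - (k + 1)) * G * outerGram W ^ (N + k)).trace := by
  set P := outerGram W
  set U := suffixProd W (k + 1) hk
  set V := suffixProd W k hk.le
  have hPk : (P ^ k).IsSymm := (isSymm_of_posSemidef (posSemidef_outerGram W)).pow k
  have hgrad : layerGrad W (G * endToEnd W) k hk = Uᵀ * G * P ^ k * V := by
    rw [layerGrad, ← Matrix.mul_assoc, Matrix.mul_assoc _ (endToEnd W),
      hW.endToEnd_mul_transpose_partialProd k hk, ← Matrix.mul_assoc]
  have hexp : N + k = k + (N - k) + k := by omega
  calc ‖layerGrad W (G * endToEnd W) k hk‖ ^ 2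
      = ((Uᵀ * G * P ^ k * V * Vᵀ * P ^ k) * (G * U)).trace := by
        rw [norm_sq_eq_trace_mul_transpose, hgrad]
        simp only [transpose_mul, transpose_transpose, hG.eq, hPk.eq, Matrix.mul_assoc]
    _ = (G * (U * Uᵀ) * G * (P ^ k * (V * Vᵀ) * P ^ k)).trace := by
        rw [trace_mul_comm]
        simp only [Matrix.mul_assoc]
    _ = _ := by
        rw [hW.suffixProd_mul_transpose, hW.suffixProd_mul_transpose, ← pow_add, ← pow_add, ← hexp]

theorem Balanced.mul_trace_conj_covariance_le (hW : Balanced W) (hN : N ≠ 0) {p : ℝ} (hp : 0 ≤ p)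
    (hcov : p ^ N • 1 ≤ covariance W) {G : Matrix (Fin (d N)) (Fin (d N)) ℝ} (hG : G.IsSymm) :
    N * p ^ (N - 1) * (G * covariance W * G).trace ≤ ‖paramGrad W (G * endToEnd W)‖ ^ 2 := by
  have hgram : p • 1 ≤ outerGram W :=
    smul_one_le_of_pow (posSemidef_outerGram W) hN (hW.covariance_eq_pow ▸ hcov)
  have hlayer (j : Fin N) : p ^ (N - 1) * (G * covariance W * G).trace
      ≤ ‖layerGrad W (G * endToEnd W) j.1 j.2‖ ^ 2 := by
    have hexp : N - 1 = N - (j.1 + 1) + j.1 := by omega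
    rw [hW.norm_layerGrad_sq hG, hW.covariance_eq_pow, hexp]
    exact pow_mul_trace_conj_pow_le hG hp hgram _ _ _
  calc N * p ^ (N - 1) * (G * covariance W * G).trace
      = ∑ _j : Fin N, p ^ (N - 1) * (G * covariance W * G).trace := by
        rw [Finset.sum_const, Finset.card_univ, Fintype.card_fin, nsmul_eq_mul, mul_assoc]
    _ ≤ ∑ j : Fin N, ‖layerGrad W (G * endToEnd W) j.1 j.2‖ ^ 2 :=
        Finset.sum_le_sum fun j _ => hlayer j
    _ = ‖paramGrad W (G * endToEnd W)‖ ^ 2 := (norm_paramGrad_sq W _).symm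

end Balanced

end Network

section Flow

open Set Filter Topology
open scoped MatrixOrder Matrix.Norms.Frobenius

theorem le_mul_exp_of_hasDerivWithinAt_Icc {f f' : ℝ → ℝ} {a b r : ℝ}
    (hf : ∀ u ∈ Icc a b, HasDerivWithinAt f (f' u) (Icc a b) u)
    (hf' : ∀ u ∈ Icc a b, f' u ≤ r * f u) {t : ℝ} (ht : t ∈ Icc a b) :
    f t ≤ f a * Real.exp (r * (t - a)) := by
  rw [← gronwallBound_ε0]
  refine le_gronwallBound_of_liminf_deriv_right_le (f' := f')
    (fun u hu => (hf u hu).continuousWithinAt) (fun u hu x hx => ?_) le_rfl (fun u hu => ?_) t ht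
  · exact ((hf u (Ico_subset_Icc_self hu)).mono_of_mem_nhdsWithin
      (Icc_mem_nhdsGE_of_mem hu)).liminf_right_slope_le hx
  · exact (hf' u (Ico_subset_Icc_self hu)).trans_eq (add_zero _).symm

variable {N : ℕ} {d : ℕ → ℕ}

theorem continuous_covariance : Continuous (covariance : Params N d → _) :=
  continuous_iff_continuousAt.2 fun W =>
    ((hasFDerivAt_mul_transpose (endToEnd W)).comp W
      (hasFDerivAt_partialProd W N le_rfl)).continuousAt

theorem isOpen_setOf_posDef_covariance : IsOpen {W : Params N d | (covariance W).PosDef} := by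
  simp only [(posSemidef_covariance _).posDef_iff_det_ne_zero]
  exact isOpen_ne_fun continuous_covariance.matrix_det continuous_const

theorem isClosed_setOf_smul_one_le_covariance (a : ℝ) :
    IsClosed {W : Params N d | a • 1 ≤ covariance W} := by
  simp only [smul_one_le_iff_forall_dotProduct (posSemidef_covariance _).isHermitian,
    ofPred_forall]
  exact isClosed_iInter fun x => isClosed_le continuous_const
    (continuous_const.dotProduct (continuous_covariance.matrix_mulVec continuous_const))

theorem layerGrad_mul_transpose_layer (W : Params N d) (Z : Matrix (Fin (d N)) (Fin (d 0)) ℝ)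
    (j : ℕ) (hj : j + 1 < N) :
    layerGrad W Z j (Nat.lt_of_succ_lt hj) * (layer W j (Nat.lt_of_succ_lt hj))ᵀ
      = (layer W (j + 1) hj)ᵀ * layerGrad W Z (j + 1) hj := by
  rw [layerGrad, layerGrad, suffixProd_eq_mul W (j + 1) hj,
    partialProd_succ W j (Nat.lt_of_succ_lt hj), transpose_mul, transpose_mul]
  simp only [Matrix.mul_assoc]

theorem Balanced.mul_paramLoss_le_norm_gradient_sq [NeZero (d N)]
    {S₀ : Matrix (Fin (d N)) (Fin (d N)) ℝ} (hS₀ : S₀.PosDef) {W : Params N d} (hW : Balanced W)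
    (hN : N ≠ 0) {p : ℝ} (hp : 0 < p) (hcov : p ^ N • 1 ≤ covariance W) :
    4 * N * p ^ (N - 1) * paramLoss S₀ W ≤ ‖gradient (paramLoss S₀) W‖ ^ 2 := by
  have hpd : (covariance W).PosDef := posDef_of_smul_one_le (pow_pos hp N) hcov
  set G := 1 - transportMap S₀ (covariance W)
  have hG : ((2 : ℝ) • G).IsSymm :=
    (isSymm_one.sub (isSymm_transportMap S₀ (covariance W))).smul (2 : ℝ)
  have htrace : ((2 : ℝ) • G * covariance W * (2 : ℝ) • G).trace = 4 * paramLoss S₀ W := by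
    have hloss : paramLoss S₀ W = (G * covariance W * G).trace := bwLoss_eq_trace hS₀ hpd
    rw [hloss, Matrix.smul_mul, Matrix.smul_mul, Matrix.mul_smul,
      smul_smul, trace_smul, smul_eq_mul]
    norm_num
  have hbound := hW.mul_trace_conj_covariance_le hN hp.le hcov hG
  rw [htrace, Matrix.smul_mul] at hbound
  rw [(hasGradientAt_paramLoss hS₀ hpd).gradient]
  linarith

namespace IsGradientFlow

variable {S₀ : Matrix (Fin (d N)) (Fin (d N)) ℝ} {T : ℝ} {W : ℝ → Params N d}

theorem mono (hflow : IsGradientFlow S₀ T W) {T' : ℝ} (h : T' ≤ T) : IsGradientFlow S₀ T' W :=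
  fun t ht => (hflow t (Icc_subset_Icc_right h ht)).mono (Icc_subset_Icc_right h)

theorem continuousOn (hflow : IsGradientFlow S₀ T W) : ContinuousOn W (Icc 0 T) :=
  fun t ht => (hflow t ht).continuousWithinAt

theorem hasDerivWithinAt_paramLoss (hflow : IsGradientFlow S₀ T W) {t : ℝ} (ht : t ∈ Icc 0 T)
    (hdiff : DifferentiableAt ℝ (paramLoss S₀) (W t)) :
    HasDerivWithinAt (fun τ => paramLoss S₀ (W τ)) (-‖gradient (paramLoss S₀) (W t)‖ ^ 2)
      (Icc 0 T) t := by
  have h := hdiff.hasGradientAt.hasFDerivAt.comp_hasDerivWithinAt t (hflow t ht)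
  rwa [InnerProductSpace.toDual_apply_apply, inner_neg_right, real_inner_self_eq_norm_sq] at h

theorem paramLoss_le (hflow : IsGradientFlow S₀ T W)
    (hdiff : ∀ t ∈ Icc 0 T, DifferentiableAt ℝ (paramLoss S₀) (W t)) {t : ℝ} (ht : t ∈ Icc 0 T) :
    paramLoss S₀ (W t) ≤ paramLoss S₀ (W 0) := by
  have h := le_mul_exp_of_hasDerivWithinAt_Icc (r := 0)
    (fun u hu => hflow.hasDerivWithinAt_paramLoss hu (hdiff u hu))
    (fun u _ => by rw [zero_mul, neg_nonpos]; positivity) ht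
  rwa [zero_mul, Real.exp_zero, mul_one] at h

variable [NeZero (d N)]

theorem hasModifiedDeficiencyMargin_of_posDef (hflow : IsGradientFlow S₀ T W) (hS₀ : S₀.PosDef)
    {c : ℝ} (hpd : ∀ t ∈ Icc 0 T, (covariance (W t)).PosDef)
    (hmargin : HasModifiedDeficiencyMargin S₀ (covariance (W 0)) c) {t : ℝ} (ht : t ∈ Icc 0 T) :
    HasModifiedDeficiencyMargin S₀ (covariance (W t)) c :=
  hmargin.of_bwLoss_le hS₀ (hpd 0 ⟨le_rfl, ht.1.trans ht.2⟩) (hpd t ht) <|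
    hflow.paramLoss_le (fun u hu => (hasGradientAt_paramLoss hS₀ (hpd u hu)).differentiableAt) ht

theorem sq_smul_one_le_covariance (hflow : IsGradientFlow S₀ T W) (hS₀ : S₀.PosDef) {c : ℝ}
    (hc : 0 < c) (hmargin : HasModifiedDeficiencyMargin S₀ (covariance (W 0)) c) {t : ℝ}
    (ht : t ∈ Icc 0 T) : c ^ 2 • 1 ≤ covariance (W t) := by
  have hbound (u : ℝ) (h : HasModifiedDeficiencyMargin S₀ (covariance (W u)) c) :
      c ^ 2 • 1 ≤ covariance (W u) :=
    (le_lambdaMin_iff (posSemidef_covariance _).isHermitian).1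
      (h.sq_le_lambdaMin hc.le (posSemidef_covariance _))
  have hclosed : IsClosed ({u | c ^ 2 • 1 ≤ covariance (W u)} ∩ Icc 0 T) := by
    rw [inter_comm]
    exact hflow.continuousOn.preimage_isClosed_of_isClosed isClosed_Icc
      (isClosed_setOf_smul_one_le_covariance (c ^ 2))
  refine hclosed.Icc_subset_of_forall_mem_nhdsGT_of_Icc_subset (hbound 0 hmargin) ?_ ht
  intro s hs hsub
  have hpd {u : ℝ} (hu : u ∈ Icc 0 s) : (covariance (W u)).PosDef :=
    posDef_of_smul_one_le (pow_pos hc 2) (hsub hu)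
  have hnear : ∀ᶠ u in 𝓝[>] s, (covariance (W u)).PosDef := by
    have hcont := (hflow.continuousOn s (Ico_subset_Icc_self hs)).mono_of_mem_nhdsWithin
      (Icc_mem_nhdsGT_of_mem hs)
    exact hcont (isOpen_setOf_posDef_covariance.mem_nhds (hpd ⟨hs.1, le_rfl⟩))
  obtain ⟨v, hv, hvpd⟩ := (mem_nhdsGT_iff_exists_Ioo_subset' hs.2).1 hnear
  filter_upwards [Ioo_mem_nhdsGT hv, Ioo_mem_nhdsGT hs.2] with u huv huT
  refine hbound u ((hflow.mono huT.2.le).hasModifiedDeficiencyMargin_of_posDef hS₀ (fun w hw => ?_)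
    hmargin ⟨hs.1.trans huv.1.le, le_rfl⟩)
  rcases le_or_gt w s with hws | hsw
  · exact hpd ⟨hw.1, hws⟩
  · exact hvpd ⟨hsw, hw.2.trans_lt huv.2⟩

theorem balanced (hflow : IsGradientFlow S₀ T W) (hS₀ : S₀.PosDef)
    (hpd : ∀ t ∈ Icc 0 T, (covariance (W t)).PosDef) (hbal : Balanced (W 0)) {t : ℝ}
    (ht : t ∈ Icc 0 T) : Balanced (W t) := by
  intro j hj
  have hj' := Nat.lt_of_succ_lt hj
  have hderiv : ∀ u ∈ Icc 0 T, HasDerivWithinAt (fun τ => layer (W τ) j hj' * (layer (W τ) j hj')ᵀ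
      - (layer (W τ) (j + 1) hj)ᵀ * layer (W τ) (j + 1) hj) 0 (Icc 0 T) u := by
    intro u hu
    have hW := hflow u hu
    rw [(hasGradientAt_paramLoss hS₀ (hpd u hu)).gradient] at hW
    set Z := (2 : ℝ) • ((1 - transportMap S₀ (covariance (W u))) * endToEnd (W u))
    have hgram := (hasFDerivAt_mul_transpose _).comp_hasDerivWithinAt u
      ((layerCLM j hj').hasFDerivAt.comp_hasDerivWithinAt u hW)
    have hgram' := (hasFDerivAt_mul_transpose _).comp_hasDerivWithinAt u
      (((transposeCLM _ _).comp (layerCLM (j + 1) hj)).hasFDerivAt.comp_hasDerivWithinAt u hW)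
    refine (hgram.sub hgram').congr_deriv ?_
    have hcomm := layerGrad_mul_transpose_layer (W u) Z j hj
    have hcomm' := congrArg transpose hcomm
    rw [transpose_mul, transpose_mul, transpose_transpose, transpose_transpose] at hcomm'
    change layer (W u) j hj' * (-layerGrad (W u) Z j hj')ᵀ
        + -layerGrad (W u) Z j hj' * (layer (W u) j hj')ᵀ
        - ((layer (W u) (j + 1) hj)ᵀ * -layerGrad (W u) Z (j + 1) hj
          + (-layerGrad (W u) Z (j + 1) hj)ᵀ * layer (W u) (j + 1) hj) = 0
    rw [transpose_neg, transpose_neg, Matrix.neg_mul, Matrix.mul_neg, Matrix.neg_mul,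
      Matrix.mul_neg, hcomm, hcomm']
    abel
  have hconst := constant_of_has_deriv_right_zero (fun u hu => (hderiv u hu).continuousWithinAt)
    (fun u hu => (hderiv u (Ico_subset_Icc_self hu)).mono_of_mem_nhdsWithin
      (Icc_mem_nhdsGE_of_mem hu)) t ht
  exact sub_eq_zero.1 (hconst.trans (sub_eq_zero.2 (hbal j hj)))

theorem paramLoss_le_mul_exp (hflow : IsGradientFlow S₀ T W) (hS₀ : S₀.PosDef) (hN : N ≠ 0)
    (hbal : Balanced (W 0)) {p : ℝ} (hp : 0 < p)
    (hcov : ∀ t ∈ Icc 0 T, p ^ N • 1 ≤ covariance (W t)) {t : ℝ} (ht : t ∈ Icc 0 T) :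
    paramLoss S₀ (W t) ≤ paramLoss S₀ (W 0) * Real.exp (-(4 * N * p ^ (N - 1)) * t) := by
  have hpd : ∀ u ∈ Icc 0 T, (covariance (W u)).PosDef := fun u hu =>
    posDef_of_smul_one_le (pow_pos hp N) (hcov u hu)
  have h := le_mul_exp_of_hasDerivWithinAt_Icc (r := -(4 * N * p ^ (N - 1)))
    (fun u hu => hflow.hasDerivWithinAt_paramLoss hu
      (hasGradientAt_paramLoss hS₀ (hpd u hu)).differentiableAt)
    (fun u hu => by
      rw [neg_mul, neg_le_neg_iff]
      exact (hflow.balanced hS₀ hpd hbal hu).mul_paramLoss_le_norm_gradient_sq hS₀ hN hp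
        (hcov u hu)) ht
  rwa [sub_zero] at h

end IsGradientFlow

end Flow

section Rate

open scoped MatrixOrder

theorem rpow_two_div_pow {c : ℝ} (hc : 0 ≤ c) {N : ℕ} (hN : N ≠ 0) :
    (c ^ ((2 : ℝ) / N)) ^ N = c ^ 2 := by
  have hN' : (N : ℝ) ≠ 0 := Nat.cast_ne_zero.2 hN
  rw [← Real.rpow_mul_natCast hc, div_mul_cancel₀ _ hN', Real.rpow_two]

theorem rpow_rate_exponent {c : ℝ} (hc : 0 < c) {N : ℕ} (hN : N ≠ 0) :
    c ^ ((2 * (2 * (N : ℝ) - 1)) / N) = (c ^ ((2 : ℝ) / N)) ^ (N - 1) * c ^ 2 := by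
  have hN' : (N : ℝ) ≠ 0 := Nat.cast_ne_zero.2 hN
  rw [← Real.rpow_mul_natCast hc.le, ← Real.rpow_two, ← Real.rpow_add hc,
    Nat.cast_pred (Nat.pos_of_ne_zero hN)]
  congr 1
  field_simp
  ring

variable {n : ℕ} [NeZero n] {S₀ S : Matrix (Fin n) (Fin n) ℝ} {c : ℝ}

theorem lambdaMin_le_constC (hS₀ : S₀.PosDef) (hS : S.PosDef) :
    lambdaMin S₀ ≤ constC S₀ S := by
  have hloss := bwLoss_nonneg hS₀ hS
  have htrace := lambdaMin_le_trace hS₀.posSemidef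
  have hpos := lambdaMin_pos hS₀
  rw [constC]
  linarith

theorem two_mul_sq_mul_constK_le_one (hS₀ : S₀.PosDef) (hS : S.PosDef)
    (hc : c ^ 2 ≤ lambdaMin S₀) : 2 * (c ^ 2 * constK S₀ S c) ≤ 1 := by
  set μ := lambdaMin S₀
  have hμ : 0 < μ := lambdaMin_pos hS₀
  have hC : μ ≤ constC S₀ S := lambdaMin_le_constC hS₀ hS
  have hsqrt : √(c ^ 2 * μ) ≤ μ :=
    Real.sqrt_le_iff.2 ⟨hμ.le, by rw [sq μ]; gcongr⟩
  have hnum : c ^ 2 * √(c ^ 2 * μ) ≤ constC S₀ S ^ 2 :=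
    calc c ^ 2 * √(c ^ 2 * μ) ≤ μ * μ := by gcongr
      _ ≤ constC S₀ S ^ 2 := by rw [← sq]; gcongr
  calc 2 * (c ^ 2 * constK S₀ S c) = c ^ 2 * √(c ^ 2 * μ) / constC S₀ S ^ 2 := by
        change 2 * (c ^ 2 * (√(c ^ 2 * μ) / (2 * constC S₀ S ^ 2))) = _
        field_simp
    _ ≤ 1 := div_le_one_of_le₀ hnum (by positivity)

theorem rate_mul_constK_le (hS₀ : S₀.PosDef) (hS : S.PosDef) (hc : 0 < c)
    (hcS₀ : c ^ 2 ≤ lambdaMin S₀) {N : ℕ} (hN : N ≠ 0) :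
    8 * N * c ^ ((2 * (2 * (N : ℝ) - 1)) / N) * constK S₀ S c
      ≤ 4 * N * (c ^ ((2 : ℝ) / N)) ^ (N - 1) :=
  calc _ = 4 * N * (c ^ ((2 : ℝ) / N)) ^ (N - 1) * (2 * (c ^ 2 * constK S₀ S c)) := by
        rw [rpow_rate_exponent hc hN]; ring
    _ ≤ _ := mul_le_of_le_one_right (by positivity) (two_mul_sq_mul_constK_le_one hS₀ hS hcS₀)

theorem IsGradientFlow.paramLoss_le_exp_constK_mul {N : ℕ} {d : ℕ → ℕ} [NeZero (d N)]
    {S₀ : Matrix (Fin (d N)) (Fin (d N)) ℝ} {T : ℝ} {W : ℝ → Params N d}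
    (hflow : IsGradientFlow S₀ T W) (hS₀ : S₀.PosDef) (hN : N ≠ 0) (hbal : Balanced (W 0))
    (hc : 0 < c) (hmargin : HasModifiedDeficiencyMargin S₀ (covariance (W 0)) c) {t : ℝ}
    (ht : t ∈ Set.Icc 0 T) :
    paramLoss S₀ (W t) ≤ Real.exp (-8 * N * c ^ ((2 * (2 * (N : ℝ) - 1)) / N)
      * constK S₀ (covariance (W 0)) c * t) * paramLoss S₀ (W 0) := by
  have hpd : (covariance (W 0)).PosDef := hmargin.posDef hc (posSemidef_covariance _)
  have hrate := rate_mul_constK_le hS₀ hpd hc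
    (hmargin.sq_le_lambdaMin_target hc.le hS₀.posSemidef) hN
  have hdecay := hflow.paramLoss_le_mul_exp hS₀ hN hbal (Real.rpow_pos_of_pos hc (2 / N))
    (fun u hu => by
      rw [rpow_two_div_pow hc.le hN]
      exact hflow.sq_smul_one_le_covariance hS₀ hc hmargin hu) ht
  have hloss : 0 ≤ paramLoss S₀ (W 0) := bwLoss_nonneg hS₀ hpd
  rw [mul_comm] at hdecay
  refine hdecay.trans (mul_le_mul_of_nonneg_right (Real.exp_le_exp.2 ?_) hloss)
  linarith [mul_le_mul_of_nonneg_right hrate ht.1]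

end Rate

end BWFlow

end

theorem mainTheorem6 (N : ℕ) (hN : 1 ≤ N) (d : ℕ → ℕ) (hd : 1 ≤ d N)
    (S₀ : Matrix (Fin (d N)) (Fin (d N)) ℝ) (hS₀ : S₀.PosSemidef)
    (c : ℝ) (hc : 0 < c) (T : ℝ) (W : ℝ → BWFlow.Params N d)
    (hflow : BWFlow.IsGradientFlow S₀ T W)
    (hbal : BWFlow.Balanced (W 0))
    (hmargin : BWFlow.HasModifiedDeficiencyMargin S₀ (BWFlow.covariance (W 0)) c)
    (Sstar : Matrix (Fin (d N)) (Fin (d N)) ℝ) (hSstar : Sstar.PosDef)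
    (hmin : IsMinOn (BWFlow.bwLoss S₀) {S | S.PosDef} Sstar) :
    ∀ t ∈ Set.Icc (0 : ℝ) T,
      DifferentiableAt ℝ (BWFlow.paramLoss S₀) (W t) ∧
      c ^ 2 ≤ BWFlow.lambdaMin (BWFlow.covariance (W t)) ∧
      BWFlow.bwLoss S₀ (BWFlow.covariance (W t)) - BWFlow.bwLoss S₀ Sstar
        ≤ Real.exp (-8 * N * c ^ ((2 * (2 * (N : ℝ) - 1)) / N)
              * BWFlow.constK S₀ (BWFlow.covariance (W 0)) c * t)
            * (BWFlow.bwLoss S₀ (BWFlow.covariance (W 0)) - BWFlow.bwLoss S₀ Sstar) ∧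
      BWFlow.bwLoss S₀ (BWFlow.covariance (W t)) - BWFlow.bwLoss S₀ Sstar
        ≤ Real.exp (-8 * N * c ^ ((2 * (2 * (N : ℝ) - 1)) / N)
              * BWFlow.constK S₀ (BWFlow.covariance (W 0)) c * t)
            * BWFlow.frobNorm (BWFlow.covariance (W 0) - Sstar) := by
  have : NeZero (d N) := ⟨Nat.one_le_iff_ne_zero.1 hd⟩
  have hpsd := BWFlow.posSemidef_covariance (W 0)
  have hS₀pd : S₀.PosDef := hmargin.posDef_target hc hS₀
  have htarget : Sstar = S₀ := BWFlow.eq_target_of_isMinOn hS₀pd hSstar hmin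
  rw [htarget, BWFlow.bwLoss_self hS₀]
  simp only [sub_zero]
  intro t ht
  have hcov := hflow.sq_smul_one_le_covariance hS₀pd hc hmargin ht
  have hpd := BWFlow.posDef_of_smul_one_le (pow_pos hc 2) hcov
  have hdecay := hflow.paramLoss_le_exp_constK_mul hS₀pd (Nat.one_le_iff_ne_zero.1 hN) hbal hc
    hmargin ht
  refine ⟨(BWFlow.hasGradientAt_paramLoss hS₀pd hpd).differentiableAt,
    (BWFlow.le_lambdaMin_iff hpd.isHermitian).2 hcov, hdecay, hdecay.trans ?_⟩
  gcongr
  exact hmargin.bwLoss_le_frobNorm_sub hc.le hS₀pd (hmargin.posDef hc hpsd)
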